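/- Let $G=(\mathcal V,\mathcal E)$ be a finite simple undirected graph, $\bar{\mathcal E}=\{(i,j) : \{i,j\}\in\mathcal E\}$ its set of directed edges. For $i\in\mathcal V$ let $\mathcal H_i$ be a real Hilbert space, and for $\{i,j\}\in\mathcal E$ let $\mathcal G_{ij}=\mathcal G_{ji}$ be a real Hilbert space, $A_{ij}:\mathcal H_i\to\mathcal G_{ij}$ and $A_{ji}:\mathcal H_j\to\mathcal G_{ij}$ continuous linear maps, $b_{ij}=b_{ji}\in\mathcal G_{ij}$, and $K_{ij}=K_{ji}\subseteq\mathcal G_{ij}$ a closed convex cone. Let $f_i$ and $h_{i,\ell}$ ($1\le \ell\le n_i$) be closed, proper, convex functions $\mathcal H_i\to\mathbb R\cup\{+\infty\}$. Put $\mathcal H=\bigoplus_i\mathcal H_i$, $N_i=\{x_i\in\mathcal H_i : h_{i,\ell}(x_i)\le 0\ \text{for all }\ell\}$ and $f(x)=\sum_{i\in\mathcal V}\big(f_i(x_i)+\iota_{N_i}(x_i)\big)$, where $\iota_S$ is $0$ on $S$ and $+\infty$ off $S$. The primal problem is $$\text{minimise } f(x)\quad\text{subject to}\quad A_{ij}x_i+A_{ji}x_j-b_{ij}\in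 K_{ij}\ \text{ for all }\{i,j\}\in\mathcal E .$$ Let $\bar{\mathcal G}=\bigoplus_{(i,j)\in\bar{\mathcal E}}\mathcal G_{ij}$, $C:\mathcal H\to\bar{\mathcal G}$, $Cx=(A_{ij}x_i)_{(i,j)}$, $d=(\tfrac12 b_{ij})_{(i,j)}$, and $M=\{\lambda\in\bar{\mathcal G} : \lambda_{i|j}\in K_{ij}^\circ \text{ and } \lambda_{i|j}=\lambda_{j|i}\text{ for all }(i,j)\in\bar{\mathcal E}\}$, where $K^\circ=\{y:\langle y,x\rangle\le 0\ \forall x\in K\}$ is the polar cone. With $f^*$ the Fenchel conjugate and $\partial$ the subdifferential, define the set-valued operators $T_1=-C\,\partial f^*(-C^*(\cdot))+d$ and $T_2=\partial\iota_M$ on $\bar{\mathcal G}$, and for $c>0$ let $R_{cT_i}=2(I+cT_i)^{-1}-I$ and $T=R_{cT_2}\circ R_{cT_1}$. Assume that $\operatorname{fix}T\neq\emptyset$ and that $\partial f$ is uniformly monotone with modulus $\phi$, i.e. $\phi:[0,\infty)\to[0,\infty)$ is nondecreasing, vanishes exactly at $0$, and $\langle v-u,y-x\rangle\ge\phi(\|y-x\|)$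 whenever $u\in\partial f(x)$, $v\in\partial f(y)$. Let $x^*$ be a solution of the primal problem (with $f(x^*)<+\infty$). Let $\chi^{(k)}=(\chi^{(k)}_{i|j})_{(i,j)\in\bar{\mathcal E}}$, $k\in\mathbb N$, be i.i.d. random vectors with values in $\{0,1\}^{\bar{\mathcal E}}$ on a probability space $(\Omega,\mathcal A,\mathcal P)$ (the entries of one vector may be dependent) such that $\mathcal P(\chi^{(0)}_{i|j}=1)>0$ for all $(i,j)\in\bar{\mathcal E}$. Then for every $z\in\bar{\mathcal G}$ the set $Tz$ is a singleton and the function $x\mapsto f(x)+\langle z,Cx\rangle+\frac c2\|Cx-d\|^2$ has exactly one minimiser. For every $z^{(0)}\in\bar{\mathcal G}$, let $Z^{(0)}=z^{(0)}$ and let $$Z^{(k+1)}=(I-U^{(k)})Z^{(k)}+U^{(k)}(TZ^{(k)}),\qquad U^{(k)}z=(\chi^{(k)}_{i|j}z_{i|j})_{(i,j)\in\bar{\mathcal E}},$$ be the stochastic Banach–Picard iteration, with primal iterates $$X^{(k)}=\arg\min_{x\in\mathcal H}\Big(f(x)+\langle Z^{(k)},Cx\rangle+\tfrac c2\|Cx-d\|^2\Big).$$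 Then $X^{(k)}\to x^*$ in norm, almost surely. -/

import Mathlib

open MeasureTheory ProbabilityTheory Filter Topology
open scoped NNReal

namespace GPDMM

noncomputable section

/-! ### Convex analysis and set-valued operators on a real Hilbert space -/

section Operators

variable {E : Type*} [NormedAddCommGroup E] [InnerProductSpace ℝ E]

/-- The class `Γ₀(E)` of closed (lower semicontinuous), proper, convex functions
`E → ℝ ∪ {+∞}`; convexity is convexity of the epigraph. -/
structure IsCCP (f : E → EReal) : Prop where
  ne_bot : ∀ x, f x ≠ ⊥
  exists_ne_top : ∃ x, f x ≠ ⊤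
  lsc : LowerSemicontinuous f
  convex : Convex ℝ {p : E × ℝ | f p.1 ≤ (p.2 : EReal)}

open Classical in
/-- The indicator function `ι_S`: `0` on `S` and `+∞` outside. -/
def indicatorFn (S : Set E) (x : E) : EReal := if x ∈ S then 0 else ⊤

/-- The Fenchel conjugate `f^*(y) = sup_x (⟨y, x⟩ - f x)`. -/
def conjugate (f : E → EReal) (y : E) : EReal :=
  ⨆ x : E, ((inner ℝ y x : ℝ) : EReal) - f x

/-- The subdifferential `∂f` as a set-valued operator. -/
def subdiff (f : E → EReal) (x : E) : Set E :=
  {u | f x ≠ ⊤ ∧ f x ≠ ⊥ ∧ ∀ y, f x + ((inner ℝ u (y - x) : ℝ) : EReal) ≤ f y}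

/-- Uniform monotonicity with modulus `φ` of a set-valued operator. -/
structure UniformlyMonotone (T : E → Set E) (φ : ℝ≥0 → ℝ≥0) : Prop where
  mono : Monotone φ
  eq_zero_iff : ∀ t, φ t = 0 ↔ t = 0
  le_inner : ∀ x y u v, u ∈ T x → v ∈ T y →
    ((φ ‖y - x‖₊ : ℝ≥0) : ℝ) ≤ inner ℝ (v - u) (y - x)

/-- The resolvent `J_{cT} = (I + cT)⁻¹`, as a set-valued operator. -/
def resolvent (c : ℝ) (T : E → Set E) (z : E) : Set E :=
  {x | ∃ u ∈ T x, x + c • u = z}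

/-- The reflected resolvent `R_{cT} = 2 J_{cT} - I`. -/
def reflectedResolvent (c : ℝ) (T : E → Set E) (z : E) : Set E :=
  {w | ∃ x ∈ resolvent c T z, w = (2 : ℝ) • x - z}

/-- The polar cone `K° = {y | ⟨y, x⟩ ≤ 0 for all x ∈ K}`. -/
def polar (K : Set E) : Set E := {y | ∀ x ∈ K, inner ℝ y x ≤ 0}

end Operators

/-! ### The conic program over a graph -/

/-- The directed edges of `G`. The pair `(i, j)` with `{i, j}` an edge is represented by the edge
`e = {i, j}` together with its endpoint `i`; thus the coordinate `z_{i|j}` is `z ⟨e, i⟩`. -/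
abbrev DirEdge {V : Type*} (G : SimpleGraph V) : Type _ :=
  (e : G.edgeSet) × {i : V // i ∈ (e : Sym2 V)}

/-- The directed edge with opposite orientation: `(i, j) ↦ (j, i)`. -/
def DirEdge.rev {V : Type*} {G : SimpleGraph V} (p : DirEdge G) : DirEdge G :=
  ⟨p.1, ⟨Sym2.Mem.other p.2.2, Sym2.other_mem p.2.2⟩⟩

/-- The data of the problem: minimise `∑ i, f i (x i)` subject to
`A_{ij} x_i + A_{ji} x_j - b_{ij} ∈ K_{ij}` for every edge `{i, j}`, and `h i ℓ (x i) ≤ 0` for every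
node `i` and every `ℓ`. For the edge `e = {i, j}`, `A e i` is `A_{ij}` and `A e j` is `A_{ji}`. -/
structure ConicProgram {V : Type*} (G : SimpleGraph V)
    (H : V → Type*) [∀ i, NormedAddCommGroup (H i)] [∀ i, InnerProductSpace ℝ (H i)]
    (Y : G.edgeSet → Type*) [∀ e, NormedAddCommGroup (Y e)]
    [∀ e, InnerProductSpace ℝ (Y e)] where
  f : ∀ i, H i → EReal
  f_ccp : ∀ i, IsCCP (f i)
  n : V → ℕ
  h : ∀ i, Fin (n i) → H i → EReal
  h_ccp : ∀ i ℓ, IsCCP (h i ℓ)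
  A : ∀ (e : G.edgeSet) (i : {i : V // i ∈ (e : Sym2 V)}), H i →L[ℝ] Y e
  b : ∀ e, Y e
  K : ∀ e, ConvexCone ℝ (Y e)
  K_closed : ∀ e, IsClosed (K e : Set (Y e))

namespace ConicProgram

variable {V : Type*} [Fintype V] [DecidableEq V] {G : SimpleGraph V} [DecidableRel G.Adj]
  {H : V → Type*} [∀ i, NormedAddCommGroup (H i)] [∀ i, InnerProductSpace ℝ (H i)]
  {Y : G.edgeSet → Type*} [∀ e, NormedAddCommGroup (Y e)] [∀ e, InnerProductSpace ℝ (Y e)]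

/-- `N_i = {x_i | h i ℓ x_i ≤ 0 for all ℓ}`. -/
def localSet (Q : ConicProgram G H Y) (i : V) : Set (H i) := {x | ∀ ℓ, Q.h i ℓ x ≤ 0}

/-- `f(x) = ∑ i, (f_i(x_i) + ι_{N_i}(x_i))` on the Hilbert direct sum of the `H i`. -/
def objective (Q : ConicProgram G H Y) (x : PiLp 2 H) : EReal :=
  ∑ i, (Q.f i (x i) + indicatorFn (Q.localSet i) (x i))

/-- The edge constraints `Ax - b ∈ K`. The sum over the two endpoints of `e = {i, j}` is
`A_{ij} x_i + A_{ji} x_j`. -/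
def Feasible (Q : ConicProgram G H Y) (x : PiLp 2 H) : Prop :=
  ∀ e : G.edgeSet, (∑ i : {i : V // i ∈ (e : Sym2 V)}, Q.A e i (x i)) - Q.b e ∈ Q.K e

/-- `x` solves the primal problem: minimise `f(x)` subject to `Ax - b ∈ K`. -/
def IsPrimalSolution (Q : ConicProgram G H Y) (x : PiLp 2 H) : Prop :=
  Q.Feasible x ∧ Q.objective x ≠ ⊤ ∧ ∀ y, Q.Feasible y → Q.objective x ≤ Q.objective y

/-- The lifted space: the Hilbert direct sum of the spaces `Y {i, j}` over the directed
edges `(i, j)`. -/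
abbrev Lifted (Y : G.edgeSet → Type*) : Type _ := PiLp 2 (fun p : DirEdge G => Y p.1)

/-- `C : (x_i)_i ↦ (A_{ij} x_i)_{(i, j)}`. -/
def C (Q : ConicProgram G H Y) : PiLp 2 H →L[ℝ] Lifted Y :=
  (PiLp.continuousLinearEquiv 2 ℝ (fun p : DirEdge G => Y p.1)).symm.toContinuousLinearMap ∘L
    ContinuousLinearMap.pi fun p : DirEdge G => Q.A p.1 p.2 ∘L PiLp.proj 2 H (p.2 : V)

/-- `d = (b_{ij} / 2)_{(i, j)}`. -/
def d (Q : ConicProgram G H Y) : Lifted Y := WithLp.toLp 2 fun p => (1 / 2 : ℝ) • Q.b p.1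

/-- The permutation `P : (λ_{i|j}) ↦ (λ_{j|i})`. -/
def perm (l : Lifted Y) : Lifted Y := WithLp.toLp 2 fun p => l p.rev

/-- `M = {λ | λ_{i|j} ∈ K_{ij}° for all (i, j), and λ = Pλ}`. -/
def M (Q : ConicProgram G H Y) : Set (Lifted Y) :=
  {l | (∀ p : DirEdge G, l p ∈ polar (Q.K p.1 : Set (Y p.1))) ∧ l = perm l}

/-- `T₁ = -C ∂f^*(-C^* ·) + d`. -/
def T₁ [∀ i, CompleteSpace (H i)] [∀ e, CompleteSpace (Y e)] (Q : ConicProgram G H Y)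
    (l : Lifted Y) : Set (Lifted Y) :=
  {w | ∃ u ∈ subdiff (conjugate Q.objective) (-(ContinuousLinearMap.adjoint Q.C l)),
    w = -Q.C u + Q.d}

/-- `T₂ = ∂ι_M`. -/
def T₂ (Q : ConicProgram G H Y) : Lifted Y → Set (Lifted Y) := subdiff (indicatorFn Q.M)

/-- `T = R_{cT₂} ∘ R_{cT₁}`. -/
def T [∀ i, CompleteSpace (H i)] [∀ e, CompleteSpace (Y e)] (Q : ConicProgram G H Y)
    (c : ℝ) (z : Lifted Y) : Set (Lifted Y) :=
  {w | ∃ y ∈ reflectedResolvent c Q.T₁ z, w ∈ reflectedResolvent c Q.T₂ y}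

/-- The primal update: the set of minimisers of `f(x) + ⟨z, Cx⟩ + (c/2) ‖Cx - d‖²`. -/
def primalUpdate (Q : ConicProgram G H Y) (c : ℝ) (z : Lifted Y) : Set (PiLp 2 H) :=
  {x | IsMinOn (fun x => Q.objective x +
    ((inner ℝ z (Q.C x) + c / 2 * ‖Q.C x - Q.d‖ ^ 2 : ℝ) : EReal)) Set.univ x}

/-- The masking operator `U : (z_{i|j}) ↦ (χ_{i|j} z_{i|j})`, `χ ∈ {0, 1}^Ē`. -/
def maskOp (s : DirEdge G → Bool) (z : Lifted Y) : Lifted Y :=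
  WithLp.toLp 2 fun p => if s p then z p else 0

/-- `Z`, `X` are generated by the stochastic Banach–Picard iteration
`Z^{(k+1)} = (I - U^{(k)}) Z^{(k)} + U^{(k)} (T Z^{(k)})` started at `z₀` and driven by the masks
`χ^{(k)}`, with primal iterates `X^{(k)} = argmin_x f(x) + ⟨Z^{(k)}, Cx⟩ + (c/2) ‖Cx - d‖²`. -/
structure IsStochasticIteration [∀ i, CompleteSpace (H i)] [∀ e, CompleteSpace (Y e)]
    (Q : ConicProgram G H Y) (c : ℝ) {Ω : Type*} (χ : ℕ → Ω → DirEdge G → Bool)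
    (z₀ : Lifted Y) (Z : ℕ → Ω → Lifted Y) (X : ℕ → Ω → PiLp 2 H) : Prop where
  init : ∀ ω, Z 0 ω = z₀
  step : ∀ k ω, ∃ w ∈ Q.T c (Z k ω),
    Z (k + 1) ω = (Z k ω - maskOp (χ k ω) (Z k ω)) + maskOp (χ k ω) w
  primal : ∀ k ω, X k ω ∈ Q.primalUpdate c (Z k ω)

end ConicProgram

end

end GPDMM

/-! Let `x`, `x'` be the primal updates at `z`, `z'`. A reflected resolvent shrinks squared
distances by `4c` times the monotonicity pairing of the operator. For `T₁` this pairing equals that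
of the subgradients of the objective at `x`, `x'`, moved through the adjoint of `C`, so it is at
least `φ ‖x - x'‖`; for `T₂` it is nonnegative. Hence `T` is nonexpansive with gain `4cφ ‖x - x'‖`
(`norm_T_sub_sq_add_le`). At a fixed point of `T` the resolvent conditions are the KKT conditions,
so the primal update there is `xstar` (`eq_of_mem_T_self`).

Weight the squared error of coordinate `p` by the inverse of its activation probability. The
expected weighted error then drops in each step by at least the expected gain
(`ae_tendsto_decrement_zero`). Only the marginals of a mask enter, so its entries may be dependent.
The gains have summable expectations, hence tend to `0` almost surely, and `φ` being monotone and
vanishing only at `0`, the primal iterates converge.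

Well-posedness needs a minimiser although `φ` may be bounded, so that coercivity is not available.
It is obtained as the limit of a Tikhonov path (`exists_norm_path_sub_lt`, `IsCCP.exists_isMinOn`).
Resolvents exist by explicit witnesses, so maximal monotonicity never enters. -/

namespace GPDMM

/-! ### Subgradients, the sum rule with a quadratic, and proximal points. -/

section ConvexAnalysis

variable {E : Type*} [NormedAddCommGroup E] [InnerProductSpace ℝ E]

theorem le_of_forall_pos_le_add_coe {a : EReal} {r : ℝ}
    (h : ∀ η : ℝ, 0 < η → a ≤ ((r + η : ℝ) : EReal)) : a ≤ r := by
  refine EReal.le_of_forall_lt_iff_le.1 fun z hz => ?_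
  have := h (z - r) (by have := EReal.coe_lt_coe_iff.1 hz; linarith)
  simpa using this

theorem IsCCP.exists_real {f : E → EReal} (hf : IsCCP f) : ∃ x, ∃ r : ℝ, f x = r := by
  obtain ⟨x, hx⟩ := hf.exists_ne_top
  exact ⟨x, (f x).toReal, (EReal.coe_toReal hx (hf.ne_bot x)).symm⟩

theorem IsCCP.le_of_le_of_le {f : E → EReal} (hf : IsCCP f) {x y : E} {a b s t : ℝ}
    (hx : f x ≤ a) (hy : f y ≤ b) (hs : 0 ≤ s) (ht : 0 ≤ t) (hst : s + t = 1) :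
    f (s • x + t • y) ≤ ((s * a + t * b : ℝ) : EReal) :=
  hf.convex (x := (x, a)) hx (y := (y, b)) hy hs ht hst

theorem IsCCP.le_of_tendsto {f : E → EReal} (hf : IsCCP f) {u : ℕ → E} {x : E}
    (hu : Tendsto u atTop (𝓝 x)) {r : ℝ} (h : ∀ᶠ n in atTop, f (u n) ≤ r) : f x ≤ r :=
  (hf.lsc.isClosed_preimage (r : EReal)).mem_of_tendsto hu h

/-- Testing against real points of the epigraph keeps all later subgradient arguments in `ℝ`. -/
theorem mem_subdiff_iff_real {f : E → EReal} {x u : E} {r : ℝ} (hx : f x = r) :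
    u ∈ subdiff f x ↔ ∀ y (a : ℝ), f y ≤ a → r + inner ℝ u (y - x) ≤ a := by
  refine ⟨fun h y a hy => ?_, fun h => ⟨by simp [hx], by simp [hx], fun y => ?_⟩⟩
  · have := (h.2.2 y).trans hy
    rw [hx] at this
    exact_mod_cast this
  · refine EReal.le_of_forall_lt_iff_le.1 fun z hz => ?_
    have := h y z hz.le
    rw [hx]
    exact_mod_cast this

theorem subdiff_exists_real {f : E → EReal} {x u : E} (h : u ∈ subdiff f x) :
    ∃ r : ℝ, f x = r :=
  ⟨(f x).toReal, (EReal.coe_toReal h.1 h.2.1).symm⟩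

theorem subdiff_inner_nonneg {f : E → EReal} {x y u v : E}
    (hu : u ∈ subdiff f x) (hv : v ∈ subdiff f y) : 0 ≤ inner ℝ (v - u) (y - x) := by
  obtain ⟨r, hr⟩ := subdiff_exists_real hu
  obtain ⟨s, hs⟩ := subdiff_exists_real hv
  have h1 := (mem_subdiff_iff_real hr).1 hu y s hs.le
  have h2 := (mem_subdiff_iff_real hs).1 hv x r hr.le
  rw [← neg_sub y x, inner_neg_right] at h2
  rw [inner_sub_left]
  linarith

/-- A subgradient gives equality in Fenchel–Young, and the conjugate is a supremum of affine
functions, one of which is then active at `v`. This half of the duality requires no convexity. -/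
theorem mem_subdiff_conjugate {f : E → EReal} {x v : E} (h : v ∈ subdiff f x) :
    x ∈ subdiff (conjugate f) v := by
  obtain ⟨r, hr⟩ := subdiff_exists_real h
  have hconj : conjugate f v = ((inner ℝ v x - r : ℝ) : EReal) := by
    refine le_antisymm (iSup_le fun y => ?_) ?_
    · have hy := h.2.2 y
      rw [hr] at hy
      induction hfy : f y with
      | bot => rw [hfy] at hy; exact absurd (le_bot_iff.1 hy) (by exact_mod_cast EReal.coe_ne_bot _)
      | top => simp
      | coe a =>
        rw [hfy] at hy
        have hy' : r + inner ℝ v (y - x) ≤ a := by exact_mod_cast hy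
        rw [inner_sub_right] at hy'
        have : inner ℝ v y - a ≤ inner ℝ v x - r := by linarith
        exact_mod_cast this
    · refine le_trans (le_of_eq ?_) (le_iSup (fun x : E => ((inner ℝ v x : ℝ) : EReal) - f x) x)
      rw [hr]; exact EReal.coe_sub _ _
  refine ⟨by rw [hconj]; exact EReal.coe_ne_top _, by rw [hconj]; exact EReal.coe_ne_bot _,
    fun w => ?_⟩
  refine le_trans (le_of_eq ?_) (le_iSup (fun x : E => ((inner ℝ w x : ℝ) : EReal) - f x) x)
  rw [hconj, hr, ← EReal.coe_add, ← EReal.coe_sub]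
  congr 1
  rw [inner_sub_right, real_inner_comm w x, real_inner_comm v x]
  ring

/-- `q` is a convex quadratic function with gradient `D` and second-order part `N`. -/
structure IsConvexQuadratic (q : E → ℝ) (D : E → E) (N : E → ℝ) : Prop where
  expand : ∀ x h (t : ℝ), q (x + t • h) = q x + t * inner ℝ (D x) h + t ^ 2 * N h
  nonneg : ∀ h, 0 ≤ N h
  continuous : Continuous q

theorem IsConvexQuadratic.add_inner_le {q : E → ℝ} {D : E → E} {N : E → ℝ}
    (hq : IsConvexQuadratic q D N) (x y : E) : q x + inner ℝ (D x) (y - x) ≤ q y := by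
  have := hq.expand x (y - x) 1
  rw [one_smul, add_sub_cancel] at this
  have := hq.nonneg (y - x)
  linarith

theorem IsConvexQuadratic.inner_sub_nonneg {q : E → ℝ} {D : E → E} {N : E → ℝ}
    (hq : IsConvexQuadratic q D N) (x y : E) : 0 ≤ inner ℝ (D y - D x) (y - x) := by
  have h1 := hq.add_inner_le x y
  have h2 := hq.add_inner_le y x
  rw [← neg_sub y x, inner_neg_right] at h2
  rw [inner_sub_left]
  linarith

theorem IsConvexQuadratic.convexOn {q : E → ℝ} {D : E → E} {N : E → ℝ}
    (hq : IsConvexQuadratic q D N) : ConvexOn ℝ Set.univ q := by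
  refine ⟨convex_univ, fun x _ y _ s t hs ht hst => ?_⟩
  set m := s • x + t • y with hm
  have h1 := mul_le_mul_of_nonneg_left (hq.add_inner_le m x) hs
  have h2 := mul_le_mul_of_nonneg_left (hq.add_inner_le m y) ht
  have h3 : s * inner ℝ (D m) (x - m) + t * inner ℝ (D m) (y - m) = 0 := by
    rw [← real_inner_smul_right, ← real_inner_smul_right, ← inner_add_right]
    have : s • (x - m) + t • (y - m) = 0 := by
      have : s • (x - m) + t • (y - m) = m - (s + t) • m := by rw [hm]; module
      rw [this, hst, one_smul, sub_self]
    rw [this, inner_zero_right]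
  simp only [smul_eq_mul]
  have h4 : q m = (s + t) * q m := by rw [hst, one_mul]
  nlinarith

theorem IsCCP.add_coe {f : E → EReal} (hf : IsCCP f) {q : E → ℝ} (hq : Continuous q)
    (hc : ConvexOn ℝ Set.univ q) : IsCCP (fun x => f x + ((q x : ℝ) : EReal)) where
  ne_bot x := by simp [EReal.add_eq_bot_iff, hf.ne_bot x]
  exists_ne_top := by
    obtain ⟨x, r, hr⟩ := hf.exists_real
    exact ⟨x, by simp only [hr]; exact_mod_cast EReal.coe_ne_top _⟩
  lsc := hf.lsc.add' (continuous_coe_real_ereal.comp hq).lowerSemicontinuous fun x =>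
    EReal.continuousAt_add (Or.inr (by simp)) (Or.inr (by simp))
  convex := by
    rintro ⟨x, a⟩ hx ⟨y, b⟩ hy s t hs ht hst
    simp only [Set.mem_ofPred_eq] at hx hy ⊢
    have key : ∀ (w : E) (r : ℝ), f w + ((q w : ℝ) : EReal) ≤ r →
        f w ≤ ((r - q w : ℝ) : EReal) := by
      intro w r h
      rw [EReal.coe_sub]
      exact EReal.le_sub_iff_add_le (by simp) (by simp) |>.2 h
    have h1 := hf.le_of_le_of_le (key x a hx) (key y b hy) hs ht hst
    have h2 := hc.2 (Set.mem_univ x) (Set.mem_univ y) hs ht hst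
    simp only [smul_eq_mul] at h2
    calc f (s • x + t • y) + ((q (s • x + t • y) : ℝ) : EReal)
        ≤ ((s * (a - q x) + t * (b - q y) : ℝ) : EReal) + ((s * q x + t * q y : ℝ) : EReal) :=
          add_le_add h1 (by exact_mod_cast h2)
      _ = ((s * a + t * b : ℝ) : EReal) := by rw [← EReal.coe_add]; congr 1; ring

/-- The sum rule for a convex function and a convex quadratic function. -/
theorem sub_mem_subdiff_of_mem_subdiff_add {f : E → EReal} (hf : IsCCP f) {q : E → ℝ} {D : E → E}
    {N : E → ℝ} (hq : IsConvexQuadratic q D N) {x u : E}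
    (h : u ∈ subdiff (fun x => f x + ((q x : ℝ) : EReal)) x) : u - D x ∈ subdiff f x := by
  have hxt : f x ≠ ⊤ := fun ht => h.1 (by simp [ht])
  obtain ⟨r, hr⟩ : ∃ r : ℝ, f x = r := ⟨_, (EReal.coe_toReal hxt (hf.ne_bot x)).symm⟩
  have hr' : (fun x => f x + ((q x : ℝ) : EReal)) x = ((r + q x : ℝ) : EReal) := by
    simp only [hr, EReal.coe_add]
  rw [mem_subdiff_iff_real (f := fun x => f x + ((q x : ℝ) : EReal)) (x := x) hr'] at h
  rw [mem_subdiff_iff_real hr]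
  intro y a hy
  by_contra! hlt
  set δ := r + inner ℝ (u - D x) (y - x) - a with hδ
  have hδ0 : 0 < δ := by linarith
  -- On the segment from `x` to `y` a first-order violation `δ` must be paid for by the second-order
  -- term, which is impossible for small `t`.
  have key : ∀ t : ℝ, 0 < t → t ≤ 1 → δ ≤ t * N (y - x) := by
    intro t ht ht1
    have h1 := hf.le_of_le_of_le hr.le hy (sub_nonneg.2 ht1) ht.le (by ring)
    have e : (1 - t) • x + t • y = x + t • (y - x) := by module
    rw [e] at h1
    have h2 := h (x + t • (y - x)) ((1 - t) * r + t * a + q (x + t • (y - x)))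
      (by rw [EReal.coe_add]; gcongr)
    rw [hq.expand, add_sub_cancel_left, inner_smul_right] at h2
    have h3 : t * δ ≤ t * (t * N (y - x)) := by
      rw [hδ, inner_sub_left]; nlinarith
    exact le_of_mul_le_mul_left h3 ht
  have hN := hq.nonneg (y - x)
  -- The `+ 1` keeps the denominator positive when `N (y - x) = 0`.
  have h1 := key (min 1 (δ / (2 * (N (y - x) + 1)))) (by positivity) (min_le_left _ _)
  have h2 : min 1 (δ / (2 * (N (y - x) + 1))) * N (y - x) ≤ δ / (2 * (N (y - x) + 1)) * N (y - x) :=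
    mul_le_mul_of_nonneg_right (min_le_right _ _) hN
  have h3 : δ / (2 * (N (y - x) + 1)) * N (y - x) < δ := by
    rw [div_mul_eq_mul_div, div_lt_iff₀ (by positivity)]
    nlinarith
  linarith

theorem mem_subdiff_add_of_sub_mem_subdiff {f : E → EReal} {q : E → ℝ} {D : E → E} {N : E → ℝ}
    (hq : IsConvexQuadratic q D N) {x u : E} (h : u - D x ∈ subdiff f x) :
    u ∈ subdiff (fun x => f x + ((q x : ℝ) : EReal)) x := by
  obtain ⟨r, hr⟩ := subdiff_exists_real h
  have hr' : (fun x => f x + ((q x : ℝ) : EReal)) x = ((r + q x : ℝ) : EReal) := by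
    simp only [hr, EReal.coe_add]
  rw [mem_subdiff_iff_real (f := fun x => f x + ((q x : ℝ) : EReal)) (x := x) hr']
  intro y a hy
  have h1 := (mem_subdiff_iff_real hr).1 h y (a - q y)
    (by rw [EReal.coe_sub]; exact EReal.le_sub_iff_add_le (by simp) (by simp) |>.2 hy)
  have h2 := hq.add_inner_le x y
  rw [inner_sub_left] at h1
  linarith

theorem zero_mem_subdiff_iff_isMinOn {g : E → EReal} (hg : IsCCP g) {x : E} :
    0 ∈ subdiff g x ↔ IsMinOn g Set.univ x := by
  refine ⟨fun h y _ => by simpa using h.2.2 y, fun h => ⟨fun ht => ?_, hg.ne_bot x, fun y => ?_⟩⟩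
  · obtain ⟨y, hy⟩ := hg.exists_ne_top
    have : g x ≤ g y := h (Set.mem_univ y)
    rw [ht] at this
    exact hy (top_le_iff.1 this)
  · simpa using h (Set.mem_univ y)

/-- A closed proper convex function decreases at most linearly. -/
theorem IsCCP.exists_linear_minorant {g : E → EReal} (hg : IsCCP g) :
    ∃ K : ℝ, 0 ≤ K ∧ ∀ y, ((-K - K * ‖y‖ : ℝ) : EReal) ≤ g y := by
  obtain ⟨x₀, r, hr⟩ := hg.exists_real
  have hl := hg.lsc x₀ ((r - 1 : ℝ) : EReal) (by
    simp only [hr]; exact_mod_cast sub_one_lt r)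
  obtain ⟨ρ, hρ, hball⟩ := Metric.eventually_nhds_iff.1 hl
  set ρ' := ρ / 2 with hρ'
  have hρ'0 : 0 < ρ' := by positivity
  -- Lower semicontinuity gives `g > r - 1` on the `ρ`-ball about `x₀`. For `y` outside it, the
  -- point of the segment at distance `ρ' < ρ` from `x₀` obeys this bound, and convexity
  -- extrapolates it to `y`.
  have key : ∀ y (a : ℝ), g y ≤ a → r - 1 - ‖y - x₀‖ / ρ' ≤ a := by
    intro y a ha
    by_cases hy : dist y x₀ < ρ
    · have h1 := (hball hy).le.trans ha
      have h1' : r - 1 ≤ a := by exact_mod_cast h1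
      have : 0 ≤ ‖y - x₀‖ / ρ' := by positivity
      linarith
    · rw [not_lt, dist_eq_norm] at hy
      have hn : 0 < ‖y - x₀‖ := lt_of_lt_of_le hρ hy
      set t := ρ' / ‖y - x₀‖ with ht
      have ht0 : 0 < t := by positivity
      have ht1 : t ≤ 1 := by rw [ht, div_le_one hn]; linarith
      have h1 := hg.le_of_le_of_le hr.le ha (sub_nonneg.2 ht1) ht0.le (by ring)
      have e : (1 - t) • x₀ + t • y = x₀ + t • (y - x₀) := by module
      rw [e] at h1
      have hd : dist (x₀ + t • (y - x₀)) x₀ < ρ := by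
        rw [dist_eq_norm, add_sub_cancel_left, norm_smul, Real.norm_of_nonneg ht0.le, ht,
          div_mul_cancel₀ _ hn.ne']
        linarith
      have h2 := (hball hd).le.trans h1
      have h2' : r - 1 ≤ (1 - t) * r + t * a := by exact_mod_cast h2
      have e2 : ‖y - x₀‖ / ρ' = 1 / t := by rw [ht]; field_simp
      rw [e2]
      have h3 : t * (r - 1 / t) ≤ t * a := by
        rw [mul_sub, mul_one_div_cancel ht0.ne']; linarith
      have := le_of_mul_le_mul_left h3 ht0
      linarith
  refine ⟨|r| + 1 + ‖x₀‖ / ρ' + 1 / ρ', by positivity, fun y => ?_⟩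
  refine EReal.le_of_forall_lt_iff_le.1 fun a ha => ?_
  have h1 := key y a ha.le
  have h2 : ‖y - x₀‖ / ρ' ≤ ‖y‖ * (1 / ρ') + ‖x₀‖ / ρ' := by
    have := div_le_div_of_nonneg_right (norm_sub_le y x₀) hρ'0.le
    calc _ ≤ _ := this
      _ = _ := by ring
  have h3 := neg_abs_le r
  have h4 : 0 ≤ (|r| + 1 + ‖x₀‖ / ρ') * ‖y‖ := by positivity
  have h5 : 0 ≤ 1 / ρ' := by positivity
  have : -(|r| + 1 + ‖x₀‖ / ρ' + 1 / ρ') - (|r| + 1 + ‖x₀‖ / ρ' + 1 / ρ') * ‖y‖ ≤ a := by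
    nlinarith
  exact_mod_cast this

theorem isConvexQuadratic_half_norm_sq {ε : ℝ} (hε : 0 ≤ ε) :
    IsConvexQuadratic (fun x : E => ε / 2 * ‖x‖ ^ 2) (fun x => ε • x)
      (fun h => ε / 2 * ‖h‖ ^ 2) where
  expand x h t := by
    rw [norm_add_sq_real, inner_smul_right, norm_smul, real_inner_smul_left, mul_pow,
      Real.norm_eq_abs, sq_abs]
    ring
  nonneg h := by positivity
  continuous := by fun_prop

/-- Existence of the proximal point of the origin. -/
theorem IsCCP.exists_neg_smul_mem_subdiff [CompleteSpace E] {g : E → EReal} (hg : IsCCP g) {ε : ℝ}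
    (hε : 0 < ε) : ∃ x, -(ε • x) ∈ subdiff g x := by
  have hquad := isConvexQuadratic_half_norm_sq (E := E) hε.le
  have hG := hg.add_coe hquad.continuous hquad.convexOn
  set G : E → EReal := fun x => g x + ((ε / 2 * ‖x‖ ^ 2 : ℝ) : EReal) with hGdef
  suffices h : ∃ x, IsMinOn G Set.univ x by
    obtain ⟨x, hx⟩ := h
    refine ⟨x, ?_⟩
    have := sub_mem_subdiff_of_mem_subdiff_add hg hquad ((zero_mem_subdiff_iff_isMinOn hG).2 hx)
    simpa using this
  have key : ∀ (w : E) (r : ℝ), G w ≤ r → g w ≤ ((r - ε / 2 * ‖w‖ ^ 2 : ℝ) : EReal) := by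
    intro w r h
    rw [EReal.coe_sub]
    exact EReal.le_sub_iff_add_le (by simp) (by simp) |>.2 h
  -- Real upper bounds of values of `G`: the infimum of `G` can then be taken in `ℝ`.
  set S : Set ℝ := {r | ∃ y, G y ≤ r} with hS
  have hSne : S.Nonempty := by
    obtain ⟨y, r, hr⟩ := hG.exists_real
    exact ⟨r, y, hr.le⟩
  have hSb : BddBelow S := by
    obtain ⟨K, hK, hmin⟩ := hg.exists_linear_minorant
    -- Complete the square in `ε / 2 * ‖y‖ ^ 2 - K * ‖y‖`.
    refine ⟨-K - K ^ 2 / (2 * ε), ?_⟩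
    rintro r ⟨y, hy⟩
    have h1 := (hmin y).trans (key y r hy)
    have h1' : -K - K * ‖y‖ ≤ r - ε / 2 * ‖y‖ ^ 2 := by exact_mod_cast h1
    have h2 : 0 ≤ (ε * ‖y‖ - K) ^ 2 / (2 * ε) := by positivity
    have h3 : (ε * ‖y‖ - K) ^ 2 / (2 * ε) = ε / 2 * ‖y‖ ^ 2 - K * ‖y‖ + K ^ 2 / (2 * ε) := by
      field_simp; ring
    linarith
  have hex : ∀ n : ℕ, ∃ y, G y ≤ ((sInf S + 1 / ((n : ℝ) + 1) : ℝ) : EReal) := by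
    intro n
    obtain ⟨r, ⟨y, hy⟩, hr⟩ := exists_lt_of_csInf_lt hSne
      (lt_add_of_pos_right (sInf S) (Nat.one_div_pos_of_nat (n := n)))
    exact ⟨y, hy.trans (by exact_mod_cast hr.le)⟩
  choose y hy using hex
  have hyN : ∀ N n : ℕ, N ≤ n → G (y n) ≤ ((sInf S + 1 / ((N : ℝ) + 1) : ℝ) : EReal) := by
    intro N n hn
    refine (hy n).trans ?_
    have : 1 / ((n : ℝ) + 1) ≤ 1 / ((N : ℝ) + 1) := Nat.one_div_le_one_div hn
    exact_mod_cast add_le_add_right this _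
  -- Strong convexity: by the parallelogram identity, the value at the midpoint would fall below the
  -- infimum if two near-minimisers were far apart.
  have hdist : ∀ N n m : ℕ, N ≤ n → N ≤ m →
      ε / 8 * ‖y n - y m‖ ^ 2 ≤ 1 / ((N : ℝ) + 1) := by
    intro N n m hn hm
    have h1 := hg.le_of_le_of_le (key _ _ (hyN N n hn)) (key _ _ (hyN N m hm))
      (by norm_num : (0 : ℝ) ≤ 1 / 2) (by norm_num : (0 : ℝ) ≤ 1 / 2) (by norm_num)
    set w := (1 / 2 : ℝ) • y n + (1 / 2 : ℝ) • y m with hw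
    have h2 : sInf S ≤ _ := csInf_le hSb ⟨w, by
      have := add_le_add_left h1 ((ε / 2 * ‖w‖ ^ 2 : ℝ) : EReal)
      rw [← EReal.coe_add] at this
      exact this⟩
    have h3 : ‖w‖ ^ 2 = 1 / 2 * ‖y n‖ ^ 2 + 1 / 2 * ‖y m‖ ^ 2 - 1 / 4 * ‖y n - y m‖ ^ 2 := by
      rw [hw, norm_add_sq_real, norm_sub_sq_real, inner_smul_left, inner_smul_right, norm_smul,
        norm_smul]
      simp
      ring
    rw [h3] at h2
    linarith
  have hcauchy : CauchySeq y := by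
    refine Metric.cauchySeq_iff.2 fun κ hκ => ?_
    obtain ⟨N, hN⟩ := exists_nat_one_div_lt (show 0 < ε / 8 * κ ^ 2 by positivity)
    refine ⟨N, fun n hn m hm => ?_⟩
    rw [dist_eq_norm]
    have h1 := (hdist N n m hn hm).trans_lt hN
    exact lt_of_pow_lt_pow_left₀ 2 hκ.le (lt_of_mul_lt_mul_left h1 (by positivity))
  obtain ⟨x, hx⟩ := cauchySeq_tendsto_of_complete hcauchy
  have hGx : G x ≤ (sInf S : ℝ) := by
    refine le_of_forall_pos_le_add_coe fun η hη => ?_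
    obtain ⟨N, hN⟩ := exists_nat_one_div_lt hη
    refine (hG.le_of_tendsto hx (eventually_atTop.2 ⟨N, hyN N⟩)).trans ?_
    exact_mod_cast add_le_add_right hN.le _
  refine ⟨x, fun z _ => hGx.trans ?_⟩
  refine EReal.le_of_forall_lt_iff_le.1 fun a ha => ?_
  exact_mod_cast csInf_le hSb ⟨z, ha.le⟩

end ConvexAnalysis

/-! ### Existence of minimisers along the regularisation path, and the augmented objective. -/

section Tikhonov

variable {E : Type*} [NormedAddCommGroup E] [InnerProductSpace ℝ E]

section Path

variable {A : E → Set E} {φ : ℝ≥0 → ℝ≥0} {x : ℝ → E}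

theorem UniformlyMonotone.le_inner_path (hA : UniformlyMonotone A φ)
    (hx : ∀ ε, 0 < ε → -(ε • x ε) ∈ A (x ε)) {ε δ : ℝ} (hε : 0 < ε) (hδ : 0 < δ) :
    ((φ ‖x ε - x δ‖₊ : ℝ≥0) : ℝ) ≤ inner ℝ (δ • x δ - ε • x ε) (x ε - x δ) := by
  have := hA.le_inner _ _ _ _ (hx δ hδ) (hx ε hε)
  rwa [neg_sub_neg] at this

theorem UniformlyMonotone.norm_path_sub_le (hA : UniformlyMonotone A φ)
    (hx : ∀ ε, 0 < ε → -(ε • x ε) ∈ A (x ε)) {ε δ : ℝ} (hε : 0 < ε) (hδ : 0 < δ) :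
    δ * ‖x δ - x ε‖ ≤ |δ - ε| * ‖x ε‖ := by
  have h1 := (NNReal.coe_nonneg _).trans (hA.le_inner_path hx hε hδ)
  have e : δ • x δ - ε • x ε = (-δ) • (x ε - x δ) + (δ - ε) • x ε := by module
  rw [e, inner_add_left, real_inner_smul_left, real_inner_self_eq_norm_sq, norm_sub_rev] at h1
  have h2 : inner ℝ ((δ - ε) • x ε) (x ε - x δ) ≤ |δ - ε| * ‖x ε‖ * ‖x δ - x ε‖ := by
    refine (real_inner_le_norm _ _).trans (le_of_eq ?_)
    rw [norm_smul, Real.norm_eq_abs, norm_sub_rev (x ε)]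
  rcases (norm_nonneg (x δ - x ε)).eq_or_lt with h0 | h0
  · rw [← h0, mul_zero]; positivity
  · refine le_of_mul_le_mul_right ?_ h0
    nlinarith

theorem UniformlyMonotone.continuousOn_path (hA : UniformlyMonotone A φ)
    (hx : ∀ ε, 0 < ε → -(ε • x ε) ∈ A (x ε)) : ContinuousOn x (Set.Ioi 0) := by
  intro ε hε
  refine ContinuousAt.continuousWithinAt ?_
  rw [ContinuousAt, tendsto_iff_norm_sub_tendsto_zero]
  have hlim : Tendsto (fun δ : ℝ => |δ - ε| * ‖x ε‖ / δ) (𝓝 ε) (𝓝 0) := by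
    have : ContinuousAt (fun δ : ℝ => |δ - ε| * ‖x ε‖ / δ) ε :=
      ContinuousAt.div (by fun_prop) continuousAt_id (ne_of_gt hε)
    simpa [ContinuousAt] using this
  refine squeeze_zero' (Eventually.of_forall fun _ => norm_nonneg _) ?_ hlim
  filter_upwards [lt_mem_nhds (Set.mem_Ioi.1 hε)] with δ hδ
  rw [le_div_iff₀ hδ, mul_comm]
  exact hA.norm_path_sub_le hx hε hδ

/-- Monotonicity, multiplied by `ε * δ`, becomes a statement about the subgradients `δ • x δ` and `ε
• x ε` alone. It makes their norms monotone in the parameter, so subgradients of nearly minimal norm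
are close to each other. -/
theorem UniformlyMonotone.norm_smul_path_sub_sq_le (hA : UniformlyMonotone A φ)
    (hx : ∀ ε, 0 < ε → -(ε • x ε) ∈ A (x ε)) {ε δ : ℝ} (hε : 0 < ε) (hδ : ε ≤ δ) :
    ‖δ • x δ - ε • x ε‖ ^ 2 ≤ ‖δ • x δ‖ ^ 2 - ‖ε • x ε‖ ^ 2 := by
  rcases hδ.eq_or_lt with rfl | hlt
  · simp
  have hδ0 := hε.trans hlt
  have h1 := (NNReal.coe_nonneg _).trans (hA.le_inner_path hx hε hδ0)
  set a := δ • x δ with ha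
  set b := ε • x ε with hb
  have e : (ε * δ) • (x ε - x δ) = δ • b - ε • a := by rw [ha, hb]; module
  have h2 : 0 ≤ inner ℝ (a - b) (δ • b - ε • a) := by
    rw [← e, real_inner_smul_right]; positivity
  clear_value a b
  rw [inner_sub_right, inner_sub_left, inner_sub_left, real_inner_smul_right,
    real_inner_smul_right, real_inner_smul_right, real_inner_smul_right,
    real_inner_self_eq_norm_sq, real_inner_self_eq_norm_sq, real_inner_comm a b] at h2
  have h3 := norm_sub_sq_real a b
  have h4 : 0 ≤ ‖a - b‖ ^ 2 := by positivity
  have h5 : (δ + ε) * ‖a - b‖ ^ 2 ≤ (δ - ε) * (‖a‖ ^ 2 - ‖b‖ ^ 2) := by rw [h3]; nlinarith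
  have h6 : 0 ≤ ‖a‖ ^ 2 - ‖b‖ ^ 2 := by
    refine le_of_mul_le_mul_left (a := δ - ε) ?_ (by linarith)
    rw [mul_zero]
    exact le_trans (by positivity) h5
  have h7 : (δ + ε) * ‖a - b‖ ^ 2 ≤ (δ + ε) * (‖a‖ ^ 2 - ‖b‖ ^ 2) := by nlinarith
  exact le_of_mul_le_mul_left h7 (by linarith)

/-- If subgradients differ by less than `φ κ / κ`, the points cannot be at distance exactly `κ`.
Large distances are not excluded this way, as `φ` may grow slower than linearly; instead the path is
continuous and starts at distance `0` from `x δ`, so it never crosses `κ`. -/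
theorem UniformlyMonotone.exists_norm_path_sub_lt (hA : UniformlyMonotone A φ)
    (hx : ∀ ε, 0 < ε → -(ε • x ε) ∈ A (x ε)) {κ : ℝ≥0} (hκ : 0 < κ) :
    ∃ δ, 0 < δ ∧ ∀ ε, 0 < ε → ε ≤ δ → ‖x ε - x δ‖ < κ := by
  have hφ : 0 < φ κ := pos_iff_ne_zero.2 fun h => hκ.ne' ((hA.eq_zero_iff κ).1 h)
  have hκ' : (0 : ℝ) < κ := hκ
  have hφ' : (0 : ℝ) < φ κ := hφ
  set S : Set ℝ := (fun ε => ‖ε • x ε‖ ^ 2) '' Set.Ioi 0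
  have hSne : S.Nonempty := ⟨_, 1, Set.mem_Ioi.2 one_pos, rfl⟩
  have hSb : BddBelow S := ⟨0, by rintro _ ⟨ε, -, rfl⟩; positivity⟩
  -- The tolerance is the square of `φ κ / κ`, the largest allowed gap between subgradients.
  obtain ⟨_, ⟨δ, hδ, rfl⟩, hlt⟩ := exists_lt_of_csInf_lt hSne
    (lt_add_of_pos_right (sInf S) (show 0 < ((φ κ : ℝ) / κ) ^ 2 by positivity))
  have hδ0 : 0 < δ := hδ
  have hne : ∀ ε, 0 < ε → ε ≤ δ → ‖x ε - x δ‖ ≠ κ := by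
    intro ε hε hle heq
    have h1 := hA.norm_smul_path_sub_sq_le hx hε hle
    have h2 : sInf S ≤ ‖ε • x ε‖ ^ 2 := csInf_le hSb ⟨ε, hε, rfl⟩
    have h3 : ‖δ • x δ - ε • x ε‖ < (φ κ : ℝ) / κ :=
      lt_of_pow_lt_pow_left₀ 2 (by positivity) (by simp only at hlt; linarith)
    have h4 := (hA.le_inner_path hx hε hδ0).trans (real_inner_le_norm _ _)
    have h5 : ‖x ε - x δ‖₊ = κ := NNReal.eq heq
    rw [h5, heq] at h4
    rw [lt_div_iff₀ hκ'] at h3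
    linarith
  refine ⟨δ, hδ, fun ε hε hle => ?_⟩
  by_contra! hge
  have hcont : ContinuousOn (fun t => ‖x t - x δ‖) (Set.Icc ε δ) :=
    (((hA.continuousOn_path hx).mono fun t ht => hε.trans_le ht.1).sub continuousOn_const).norm
  obtain ⟨t, ht, hte⟩ := intermediate_value_Icc' hle hcont
    (show (κ : ℝ) ∈ Set.Icc _ _ from ⟨by simp, hge⟩)
  exact hne t (hε.trans_le ht.1) ht.2 hte

theorem UniformlyMonotone.exists_tendsto_path [CompleteSpace E] (hA : UniformlyMonotone A φ)
    (hx : ∀ ε, 0 < ε → -(ε • x ε) ∈ A (x ε)) :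
    ∃ y, Tendsto (fun n : ℕ => x (1 / ((n : ℝ) + 1))) atTop (𝓝 y) := by
  refine cauchySeq_tendsto_of_complete (Metric.cauchySeq_iff.2 fun κ hκ => ?_)
  obtain ⟨δ, hδ, h⟩ := hA.exists_norm_path_sub_lt hx (κ := (⟨κ / 2, by positivity⟩ : ℝ≥0))
    (show (0 : ℝ) < κ / 2 by positivity)
  obtain ⟨N, hN⟩ := exists_nat_one_div_lt hδ
  have key : ∀ n, N ≤ n → dist (x (1 / ((n : ℝ) + 1))) (x δ) < κ / 2 := by
    intro n hn
    rw [dist_eq_norm]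
    exact h _ Nat.one_div_pos_of_nat ((Nat.one_div_le_one_div hn).trans hN.le)
  refine ⟨N, fun n hn m hm => ?_⟩
  have h1 := key n hn
  have h2 := key m hm
  have h3 := dist_triangle_right (x (1 / ((n : ℝ) + 1))) (x (1 / ((m : ℝ) + 1))) (x δ)
  linarith

end Path

/-- A closed proper convex function with uniformly monotone subdifferential has a minimiser,
whatever the growth of the modulus. -/
theorem IsCCP.exists_isMinOn [CompleteSpace E] {g : E → EReal} (hg : IsCCP g) {φ : ℝ≥0 → ℝ≥0}
    (hA : UniformlyMonotone (subdiff g) φ) : ∃ x, IsMinOn g Set.univ x := by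
  have hex : ∀ ε : ℝ, ∃ x, 0 < ε → -(ε • x) ∈ subdiff g x := by
    intro ε
    by_cases hε : 0 < ε
    · obtain ⟨x, hx⟩ := hg.exists_neg_smul_mem_subdiff hε
      -- For `ε ≤ 0` the path takes the junk value `0` below.
      exact ⟨x, fun _ => hx⟩
    · exact ⟨0, fun h => absurd h hε⟩
  choose x hx using hex
  obtain ⟨y, hy⟩ := hA.exists_tendsto_path hx
  refine ⟨y, fun z _ => EReal.le_of_forall_lt_iff_le.1 fun a ha => ?_⟩
  refine le_of_forall_pos_le_add_coe fun η hη => hg.le_of_tendsto hy ?_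
  -- The path converges, hence is bounded along this sequence, so its subgradients vanish in the
  -- limit; lower semicontinuity does the rest.
  have hlim : Tendsto (fun n : ℕ => inner ℝ (-((1 / ((n : ℝ) + 1)) • x (1 / ((n : ℝ) + 1))))
      (z - x (1 / ((n : ℝ) + 1)))) atTop (𝓝 0) := by
    have h := (((tendsto_one_div_add_atTop_nhds_zero_nat (𝕜 := ℝ)).smul hy).neg).inner (𝕜 := ℝ)
      ((tendsto_const_nhds (x := z)).sub hy)
    simpa using h
  filter_upwards [hlim.eventually (lt_mem_nhds (neg_lt_zero.2 hη))] with n hn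
  have hmem := hx (1 / ((n : ℝ) + 1)) Nat.one_div_pos_of_nat
  obtain ⟨r, hr⟩ := subdiff_exists_real hmem
  have h1 := (mem_subdiff_iff_real hr).1 hmem z a ha.le
  rw [hr]
  have : r ≤ a + η := by linarith
  exact_mod_cast this

variable {F : Type*} [NormedAddCommGroup F] [InnerProductSpace ℝ F]

theorem isConvexQuadratic_augmented [CompleteSpace E] [CompleteSpace F] (C : E →L[ℝ] F) (z d : F)
    {c : ℝ} (hc : 0 ≤ c) :
    IsConvexQuadratic (fun x => inner ℝ z (C x) + c / 2 * ‖C x - d‖ ^ 2)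
      (fun x => ContinuousLinearMap.adjoint C (z + c • (C x - d)))
      (fun h => c / 2 * ‖C h‖ ^ 2) where
  expand x h t := by
    have e : C (x + t • h) - d = (C x - d) + t • C h := by
      rw [map_add, map_smul]; abel
    rw [e, ContinuousLinearMap.adjoint_inner_left, norm_add_sq_real, map_add, map_smul,
      inner_add_right, inner_add_left, real_inner_smul_right, real_inner_smul_right,
      real_inner_smul_left, norm_smul, mul_pow, Real.norm_eq_abs, sq_abs]
    ring
  nonneg h := by positivity
  continuous := by fun_prop

theorem IsCCP.add_augmented {f : E → EReal} [CompleteSpace E] [CompleteSpace F] (hf : IsCCP f)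
    (C : E →L[ℝ] F) (z d : F) {c : ℝ} (hc : 0 ≤ c) :
    IsCCP (fun x => f x + ((inner ℝ z (C x) + c / 2 * ‖C x - d‖ ^ 2 : ℝ) : EReal)) :=
  hf.add_coe (isConvexQuadratic_augmented C z d hc).continuous
    (isConvexQuadratic_augmented C z d hc).convexOn

/-- The optimality condition of the primal update. -/
theorem isMinOn_augmented_iff [CompleteSpace E] [CompleteSpace F] {f : E → EReal} (hf : IsCCP f)
    (C : E →L[ℝ] F) (z d : F) {c : ℝ} (hc : 0 ≤ c) {x : E} :
    IsMinOn (fun x => f x + ((inner ℝ z (C x) + c / 2 * ‖C x - d‖ ^ 2 : ℝ) : EReal)) Set.univ x ↔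
      -ContinuousLinearMap.adjoint C (z + c • (C x - d)) ∈ subdiff f x := by
  have hq := isConvexQuadratic_augmented C z d hc
  rw [← zero_mem_subdiff_iff_isMinOn (hf.add_augmented C z d hc), ← zero_sub]
  exact ⟨sub_mem_subdiff_of_mem_subdiff_add hf hq, mem_subdiff_add_of_sub_mem_subdiff hq⟩

theorem UniformlyMonotone.add_augmented [CompleteSpace E] [CompleteSpace F] {f : E → EReal}
    (hf : IsCCP f) {φ : ℝ≥0 → ℝ≥0} (hφ : UniformlyMonotone (subdiff f) φ)
    (C : E →L[ℝ] F) (z d : F) {c : ℝ} (hc : 0 ≤ c) :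
    UniformlyMonotone (subdiff fun x =>
      f x + ((inner ℝ z (C x) + c / 2 * ‖C x - d‖ ^ 2 : ℝ) : EReal)) φ where
  mono := hφ.mono
  eq_zero_iff := hφ.eq_zero_iff
  le_inner x y u v hu hv := by
    have hq := isConvexQuadratic_augmented C z d hc
    have h1 := hφ.le_inner x y _ _ (sub_mem_subdiff_of_mem_subdiff_add hf hq hu)
      (sub_mem_subdiff_of_mem_subdiff_add hf hq hv)
    have h2 := hq.inner_sub_nonneg x y
    rw [sub_sub_sub_comm, inner_sub_left] at h1
    linarith

theorem UniformlyMonotone.eq_of_mem_of_mem {A : E → Set E} {φ : ℝ≥0 → ℝ≥0}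
    (hA : UniformlyMonotone A φ) {x y u : E} (hx : u ∈ A x) (hy : u ∈ A y) : x = y := by
  have h := hA.le_inner x y u u hx hy
  rw [sub_self, inner_zero_left] at h
  have h0 : φ ‖y - x‖₊ = 0 := le_antisymm (by exact_mod_cast h) zero_le
  have := (hA.eq_zero_iff _).1 h0
  rw [nnnorm_eq_zero, sub_eq_zero] at this
  exact this.symm

theorem existsUnique_isMinOn_augmented [CompleteSpace E] [CompleteSpace F] {f : E → EReal}
    (hf : IsCCP f) {φ : ℝ≥0 → ℝ≥0} (hφ : UniformlyMonotone (subdiff f) φ)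
    (C : E →L[ℝ] F) (z d : F) {c : ℝ} (hc : 0 ≤ c) :
    ∃! x, IsMinOn (fun x => f x + ((inner ℝ z (C x) + c / 2 * ‖C x - d‖ ^ 2 : ℝ) : EReal))
      Set.univ x := by
  have hg := hf.add_augmented C z d hc
  have hu := hφ.add_augmented hf C z d hc
  obtain ⟨x, hx⟩ := hg.exists_isMinOn hu
  exact ⟨x, hx, fun y hy => hu.eq_of_mem_of_mem ((zero_mem_subdiff_iff_isMinOn hg).2 hy)
    ((zero_mem_subdiff_iff_isMinOn hg).2 hx)⟩

end Tikhonov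

/-! ### Random coordinate updates. -/

section Stochastic

variable {ι : Type*} {Y : ι → Type*} {Ω : Type*}

/-- Dependence on the past masks alone makes `Z k` independent of `χ k`. With finitely many
coordinates it also takes finitely many values, so no measurability of `T` is needed. -/
theorem exists_eq_comp_restrict {T : PiLp 2 Y → PiLp 2 Y} {χ : ℕ → Ω → ι → Bool}
    {Z : ℕ → Ω → PiLp 2 Y} {z₀ : PiLp 2 Y} (h0 : ∀ ω, Z 0 ω = z₀)
    (hstep : ∀ k ω p, Z (k + 1) ω p = if χ k ω p then T (Z k ω) p else Z k ω p) (k : ℕ) :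
    ∃ g : (Finset.range k → ι → Bool) → PiLp 2 Y,
      ∀ ω, Z k ω = g fun i : Finset.range k => χ i ω := by
  induction k with
  | zero => exact ⟨fun _ => z₀, h0⟩
  | succ k ih =>
    obtain ⟨g, hg⟩ := ih
    refine ⟨fun s => WithLp.toLp 2 fun p =>
      if s ⟨k, Finset.self_mem_range_succ k⟩ p then
        T (g fun i => s ⟨i, Finset.range_subset_range.2 k.le_succ i.2⟩) p
      else g (fun i => s ⟨i, Finset.range_subset_range.2 k.le_succ i.2⟩) p, fun ω => ?_⟩
    ext p
    rw [hstep, hg]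

variable [MeasurableSpace Ω] {μ : Measure Ω}

theorem integrable_comp_of_finite [IsProbabilityMeasure μ] {S : Type*} [Finite S]
    [MeasurableSpace S] [MeasurableSingletonClass S] {t : Ω → S} (ht : Measurable t) (F : S → ℝ) :
    Integrable (fun ω => F (t ω)) μ := by
  have : IsFiniteMeasure (μ.map t) := inferInstance
  exact (Integrable.of_finite (μ := μ.map t) (f := F)).comp_measurable ht

/-- The integrand is `a + (b - a)` times the indicator of the mask, and the last product factors by
independence. -/
theorem integral_mask_add [IsProbabilityMeasure μ] {S R : Type*}
    [Finite S] [MeasurableSpace S] [MeasurableSingletonClass S]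
    [Finite R] [MeasurableSpace R] [MeasurableSingletonClass R]
    {t : Ω → S} (ht : Measurable t) {s : Ω → R} (hs : Measurable s) (hind : IndepFun t s μ)
    (m : R → Bool) (a b : S → ℝ) :
    ∫ ω, (if m (s ω) then b (t ω) else a (t ω)) ∂μ =
      ∫ ω, a (t ω) ∂μ +
        μ.real {ω | m (s ω) = true} * (∫ ω, b (t ω) ∂μ - ∫ ω, a (t ω) ∂μ) := by
  have e : (fun ω => if m (s ω) then b (t ω) else a (t ω)) = fun ω =>
      a (t ω) + (fun ω => b (t ω) - a (t ω)) ω * (fun ω => if m (s ω) then (1 : ℝ) else 0) ω := by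
    funext ω
    by_cases h : m (s ω) <;> simp [h]
  have hind' : IndepFun (fun ω => b (t ω) - a (t ω)) (fun ω => if m (s ω) then (1 : ℝ) else 0) μ :=
    hind.comp (φ := fun x => b x - a x) (ψ := fun x => if m x then (1 : ℝ) else 0)
      (measurable_of_finite _) (measurable_of_finite _)
  have hset : MeasurableSet {ω | m (s ω) = true} :=
    hs (Set.toFinite {x | m x = true}).measurableSet
  have hI1 : Integrable (fun ω => b (t ω) - a (t ω)) μ :=
    integrable_comp_of_finite ht fun x => b x - a x
  have hI2 : Integrable (fun ω => if m (s ω) then (1 : ℝ) else 0) μ :=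
    integrable_comp_of_finite hs fun x => if m x then (1 : ℝ) else 0
  have hprob : ∫ ω, (if m (s ω) then (1 : ℝ) else 0) ∂μ = μ.real {ω | m (s ω) = true} := by
    rw [← integral_indicator_one hset]
    congr 1
    funext ω
    simp [Set.indicator_apply]
  have hI3 : Integrable (fun ω => (fun ω => b (t ω) - a (t ω)) ω *
      (fun ω => if m (s ω) then (1 : ℝ) else 0) ω) μ := hind'.integrable_mul hI1 hI2
  rw [e, integral_add (integrable_comp_of_finite ht a) hI3,
    hind'.integral_fun_mul_eq_mul_integral hI1.aestronglyMeasurable hI2.aestronglyMeasurable,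
    integral_sub (integrable_comp_of_finite ht b) (integrable_comp_of_finite ht a), hprob]
  ring

/-- By Tonelli the series of the `ψ k` has finite expectation, so it converges almost surely. This
replaces a supermartingale argument. -/
theorem ae_tendsto_zero_of_sum_integral_le {ψ : ℕ → Ω → ℝ} (hpos : ∀ k ω, 0 ≤ ψ k ω)
    (hint : ∀ k, Integrable (ψ k) μ) {B : ℝ} (hB : ∀ n, ∑ k ∈ Finset.range n, ∫ ω, ψ k ω ∂μ ≤ B) :
    ∀ᵐ ω ∂μ, Tendsto (fun k => ψ k ω) atTop (𝓝 0) := by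
  have hm : ∀ k, AEMeasurable (fun ω => ENNReal.ofReal (ψ k ω)) μ :=
    fun k => (hint k).aemeasurable.ennreal_ofReal
  have hsum : ∫⁻ ω, ∑' k, ENNReal.ofReal (ψ k ω) ∂μ ≤ ENNReal.ofReal B := by
    rw [lintegral_tsum hm]
    refine ENNReal.tsum_le_of_sum_range_le fun n => ?_
    calc ∑ k ∈ Finset.range n, ∫⁻ ω, ENNReal.ofReal (ψ k ω) ∂μ
        = ∑ k ∈ Finset.range n, ENNReal.ofReal (∫ ω, ψ k ω ∂μ) :=
          Finset.sum_congr rfl fun k _ =>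
            (ofReal_integral_eq_lintegral_ofReal (hint k) (ae_of_all _ (hpos k))).symm
      _ = ENNReal.ofReal (∑ k ∈ Finset.range n, ∫ ω, ψ k ω ∂μ) :=
          (ENNReal.ofReal_sum_of_nonneg fun k _ => integral_nonneg (hpos k)).symm
      _ ≤ ENNReal.ofReal B := ENNReal.ofReal_le_ofReal (hB n)
  have hae := ae_lt_top' (AEMeasurable.tsum hm)
    (ne_top_of_le_ne_top ENNReal.ofReal_ne_top hsum)
  filter_upwards [hae] with ω hω
  have h := ENNReal.tendsto_atTop_zero_of_tsum_ne_top hω.ne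
  have hreal := (ENNReal.tendsto_toReal ENNReal.zero_ne_top).comp h
  simpa [Function.comp_def, ENNReal.toReal_ofReal (hpos _ _)] using hreal

/-- Randomly masked iterations of a map that moves closer to `zs` by `ψ` in squared norm: the
decrements `ψ` vanish along almost every trajectory. -/
theorem ae_tendsto_decrement_zero [IsProbabilityMeasure μ] [Fintype ι]
    [∀ p, NormedAddCommGroup (Y p)] {T : PiLp 2 Y → PiLp 2 Y} {ψ : PiLp 2 Y → ℝ}
    {zs : PiLp 2 Y} (hψ : ∀ z, 0 ≤ ψ z)
    (hT : ∀ z, ‖T z - zs‖ ^ 2 + ψ z ≤ ‖z - zs‖ ^ 2)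
    {χ : ℕ → Ω → ι → Bool} (hmeas : ∀ k, Measurable (χ k)) (hindep : iIndepFun χ μ)
    (hident : ∀ k, IdentDistrib (χ k) (χ 0) μ μ) (hpos : ∀ p, 0 < μ {ω | χ 0 ω p = true})
    {Z : ℕ → Ω → PiLp 2 Y} {z₀ : PiLp 2 Y} (h0 : ∀ ω, Z 0 ω = z₀)
    (hstep : ∀ k ω p, Z (k + 1) ω p = if χ k ω p then T (Z k ω) p else Z k ω p) :
    ∀ᵐ ω ∂μ, Tendsto (fun k => ψ (Z k ω)) atTop (𝓝 0) := by
  choose g hg using exists_eq_comp_restrict h0 hstep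
  have ht : ∀ k, Measurable fun ω => fun i : Finset.range k => χ i ω :=
    fun k => measurable_pi_lambda _ fun i => hmeas i
  have hint : ∀ (F : PiLp 2 Y → ℝ) k, Integrable (fun ω => F (Z k ω)) μ := by
    intro F k
    simp only [hg k]
    exact integrable_comp_of_finite (ht k) fun s => F (g k s)
  set π : ι → ℝ := fun p => μ.real {ω | χ 0 ω p = true} with hπ
  have hπ0 : ∀ p, 0 < π p := fun p => ENNReal.toReal_pos (hpos p).ne' (measure_ne_top _ _)
  have hprob : ∀ k p, μ.real {ω | χ k ω p = true} = π p := by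
    intro k p
    have := (hident k).measure_mem_eq (s := {s | s p = true}) (Set.toFinite _).measurableSet
    exact congrArg ENNReal.toReal this
  have hexp : ∀ k p, ∫ ω, ‖Z (k + 1) ω p - zs p‖ ^ 2 ∂μ = ∫ ω, ‖Z k ω p - zs p‖ ^ 2 ∂μ +
      π p * (∫ ω, ‖T (Z k ω) p - zs p‖ ^ 2 ∂μ - ∫ ω, ‖Z k ω p - zs p‖ ^ 2 ∂μ) := by
    intro k p
    have hind : IndepFun (fun ω => fun i : Finset.range k => χ i ω) (χ k) μ :=
      (hindep.indepFun_finset (Finset.range k) {k} (by simp) hmeas).comp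
        (φ := id) (ψ := fun s : ({k} : Finset ℕ) → ι → Bool => s ⟨k, Finset.mem_singleton_self k⟩)
        measurable_id (measurable_of_finite _)
    have := integral_mask_add (ht k) (hmeas k) hind (fun s => s p)
      (fun s => ‖g k s p - zs p‖ ^ 2) (fun s => ‖T (g k s) p - zs p‖ ^ 2)
    simp only [← hg k, hprob k p] at this
    rw [← this]
    congr 1
    funext ω
    rw [hstep]
    split_ifs <;> rfl
  -- The weight `(π p)⁻¹` cancels the factor `π p` in `hexp`, so `W` changes as if every coordinate
  -- were updated in the unweighted norm.
  set W : ℕ → ℝ := fun k => ∑ p, (π p)⁻¹ * ∫ ω, ‖Z k ω p - zs p‖ ^ 2 ∂μ with hW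
  have hW0 : ∀ k, 0 ≤ W k := fun k => Finset.sum_nonneg fun p _ =>
    mul_nonneg (inv_nonneg.2 (hπ0 p).le) (integral_nonneg fun ω => by positivity)
  have hdec : ∀ k, W (k + 1) + ∫ ω, ψ (Z k ω) ∂μ ≤ W k := by
    intro k
    have h1 : W (k + 1) = W k + (∑ p, ∫ ω, ‖T (Z k ω) p - zs p‖ ^ 2 ∂μ -
        ∑ p, ∫ ω, ‖Z k ω p - zs p‖ ^ 2 ∂μ) := by
      simp only [hW, hexp k]
      rw [← Finset.sum_sub_distrib, ← Finset.sum_add_distrib]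
      refine Finset.sum_congr rfl fun p _ => ?_
      rw [mul_add, inv_mul_cancel_left₀ (hπ0 p).ne']
    have hsum : ∀ F : PiLp 2 Y → PiLp 2 Y, ∑ p, ∫ ω, ‖F (Z k ω) p - zs p‖ ^ 2 ∂μ =
        ∫ ω, ‖F (Z k ω) - zs‖ ^ 2 ∂μ := by
      intro F
      rw [← integral_finsetSum _ fun p _ => hint (fun z => ‖F z p - zs p‖ ^ 2) k]
      congr 1
      funext ω
      rw [PiLp.norm_sq_eq_of_L2]
      rfl
    have h2 := hsum T
    have h3 := hsum id
    simp only [id] at h3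
    have h4 : ∫ ω, (‖T (Z k ω) - zs‖ ^ 2 + ψ (Z k ω)) ∂μ ≤ ∫ ω, ‖Z k ω - zs‖ ^ 2 ∂μ :=
      integral_mono (hint (fun z => ‖T z - zs‖ ^ 2 + ψ z) k) (hint (fun z => ‖z - zs‖ ^ 2) k)
        fun ω => hT _
    rw [integral_add (hint (fun z => ‖T z - zs‖ ^ 2) k) (hint ψ k)] at h4
    rw [h1, h2, h3]
    linarith
  refine ae_tendsto_zero_of_sum_integral_le (fun k ω => hψ _) (hint ψ) (B := W 0) fun n => ?_
  have : ∑ k ∈ Finset.range n, ∫ ω, ψ (Z k ω) ∂μ + W n ≤ W 0 := by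
    induction n with
    | zero => simp
    | succ n ih =>
      rw [Finset.sum_range_succ]
      have := hdec n
      linarith
  have := hW0 n
  linarith

end Stochastic

/-! ### Closed convex functions under sums, composition and indicators. -/

section ClosedConvex

variable {E : Type*} [NormedAddCommGroup E] [InnerProductSpace ℝ E]

/-- Closed convex functions, without the requirement that they be finite somewhere. -/
structure IsClosedConvex (f : E → EReal) : Prop where
  ne_bot : ∀ x, f x ≠ ⊥
  lsc : LowerSemicontinuous f
  convex : Convex ℝ {p : E × ℝ | f p.1 ≤ (p.2 : EReal)}

theorem IsCCP.isClosedConvex {f : E → EReal} (hf : IsCCP f) : IsClosedConvex f :=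
  ⟨hf.ne_bot, hf.lsc, hf.convex⟩

theorem exists_real_of_add_le {a b : EReal} {r : ℝ} (ha : a ≠ ⊥) (hb : b ≠ ⊥) (h : a + b ≤ r) :
    ∃ s t : ℝ, a = s ∧ b = t ∧ s + t ≤ r := by
  induction a with
  | bot => exact absurd rfl ha
  | top => rw [EReal.top_add_of_ne_bot hb] at h; exact absurd (top_le_iff.1 h) (EReal.coe_ne_top r)
  | coe s =>
    induction b with
    | bot => exact absurd rfl hb
    | top => rw [EReal.coe_add_top] at h; exact absurd (top_le_iff.1 h) (EReal.coe_ne_top r)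
    | coe t => exact ⟨s, t, rfl, rfl, by exact_mod_cast h⟩

theorem IsClosedConvex.add {f g : E → EReal} (hf : IsClosedConvex f) (hg : IsClosedConvex g) :
    IsClosedConvex fun x => f x + g x where
  ne_bot x := by simp [EReal.add_eq_bot_iff, hf.ne_bot x, hg.ne_bot x]
  lsc := hf.lsc.add' hg.lsc fun x =>
    EReal.continuousAt_add (Or.inr (hg.ne_bot x)) (Or.inl (hf.ne_bot x))
  convex := by
    rintro ⟨x, a⟩ hx ⟨y, b⟩ hy s t hs ht hst
    obtain ⟨a₁, a₂, h1, h2, ha⟩ := exists_real_of_add_le (hf.ne_bot x) (hg.ne_bot x) hx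
    obtain ⟨b₁, b₂, h3, h4, hb⟩ := exists_real_of_add_le (hf.ne_bot y) (hg.ne_bot y) hy
    have h5 : f (s • x + t • y) ≤ ((s * a₁ + t * b₁ : ℝ) : EReal) :=
      hf.convex (x := (x, a₁)) h1.le (y := (y, b₁)) h3.le hs ht hst
    have h6 : g (s • x + t • y) ≤ ((s * a₂ + t * b₂ : ℝ) : EReal) :=
      hg.convex (x := (x, a₂)) h2.le (y := (y, b₂)) h4.le hs ht hst
    have h7 : s * a₁ + t * b₁ + (s * a₂ + t * b₂) ≤ s * a + t * b := by
      nlinarith [mul_le_mul_of_nonneg_left ha hs, mul_le_mul_of_nonneg_left hb ht]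
    refine (add_le_add h5 h6).trans ?_
    rw [← EReal.coe_add]
    exact EReal.coe_le_coe_iff.2 h7

theorem isClosedConvex_zero : IsClosedConvex fun _ : E => (0 : EReal) where
  ne_bot _ := EReal.zero_ne_bot
  lsc := lowerSemicontinuous_const
  convex := by
    rintro ⟨x, a⟩ hx ⟨y, b⟩ hy s t hs ht hst
    have ha : 0 ≤ a := EReal.coe_nonneg.1 hx
    have hb : 0 ≤ b := EReal.coe_nonneg.1 hy
    have : 0 ≤ s * a + t * b := by positivity
    exact EReal.coe_nonneg.2 this

theorem isClosedConvex_sum {ι : Type*} (I : Finset ι) {f : ι → E → EReal}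
    (hf : ∀ i, IsClosedConvex (f i)) : IsClosedConvex fun x => ∑ i ∈ I, f i x := by
  classical
  induction I using Finset.induction_on with
  | empty => simpa using isClosedConvex_zero
  | insert i I hi ih =>
    simp only [Finset.sum_insert hi]
    exact (hf i).add ih

theorem IsClosedConvex.comp {F : Type*} [NormedAddCommGroup F] [InnerProductSpace ℝ F]
    {f : F → EReal} (hf : IsClosedConvex f) (L : E →L[ℝ] F) : IsClosedConvex fun x => f (L x) where
  ne_bot x := hf.ne_bot _
  lsc := hf.lsc.comp L.continuous
  convex := by
    rintro ⟨x, a⟩ hx ⟨y, b⟩ hy s t hs ht hst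
    have : f (s • L x + t • L y) ≤ ((s * a + t * b : ℝ) : EReal) :=
      hf.convex (x := (L x, a)) hx (y := (L y, b)) hy hs ht hst
    rw [← map_smul, ← map_smul, ← map_add] at this
    exact this

theorem indicatorFn_le_coe_iff {α : Type*} {S : Set α} {x : α} {a : ℝ} :
    indicatorFn S x ≤ a ↔ x ∈ S ∧ 0 ≤ a := by
  unfold indicatorFn
  split_ifs with h <;> simp [h]

theorem isClosedConvex_indicatorFn {S : Set E} (hS : IsClosed S) (hc : Convex ℝ S) :
    IsClosedConvex (indicatorFn S) where
  ne_bot x := by unfold indicatorFn; split_ifs <;> simp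
  lsc := by
    refine lowerSemicontinuous_iff_isClosed_preimage.2 fun a => ?_
    by_cases ha : a = ⊤
    · simp [ha]
    by_cases h0 : 0 ≤ a
    · convert hS using 1
      ext x
      simp only [Set.mem_preimage, Set.mem_Iic, indicatorFn]
      split_ifs with h <;> simp [h, h0, ha]
    · convert isClosed_empty using 1
      ext x
      simp only [Set.mem_preimage, Set.mem_Iic, indicatorFn]
      split_ifs with h <;> simp [h0, ha]
  convex := by
    rintro ⟨x, a⟩ hx ⟨y, b⟩ hy s t hs ht hst
    have hx' := indicatorFn_le_coe_iff.1 hx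
    have hy' := indicatorFn_le_coe_iff.1 hy
    refine indicatorFn_le_coe_iff.2 ⟨hc hx'.1 hy'.1 hs ht hst, ?_⟩
    have h1 := hx'.2
    have h2 := hy'.2
    change 0 ≤ s * a + t * b
    simp only at h1 h2
    positivity

end ClosedConvex

/-! ### Resolvents of monotone operators, projections and polar cones. -/

section Resolvents

variable {E : Type*} [NormedAddCommGroup E] [InnerProductSpace ℝ E]

/-- Since `z = x + c • u` and its reflection is `x - c • u`, the two squared norms differ only in
the sign of the cross term. -/
theorem norm_reflected_sub_sq {c : ℝ} {x x' u u' z z' : E} (h : x + c • u = z)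
    (h' : x' + c • u' = z') :
    ‖((2 : ℝ) • x - z) - ((2 : ℝ) • x' - z')‖ ^ 2 + 4 * c * inner ℝ (u - u') (x - x') =
      ‖z - z'‖ ^ 2 := by
  have e1 : ((2 : ℝ) • x - z) - ((2 : ℝ) • x' - z') = (x - x') - c • (u - u') := by
    rw [← h, ← h']; module
  have e2 : z - z' = (x - x') + c • (u - u') := by rw [← h, ← h']; module
  rw [e1, e2, norm_sub_sq_real, norm_add_sq_real, real_inner_smul_right, real_inner_comm]
  ring

theorem eq_of_mem_resolvent {A : E → Set E}
    (hA : ∀ x y u v, u ∈ A x → v ∈ A y → 0 ≤ inner ℝ (v - u) (y - x)) {c : ℝ} (hc : 0 < c)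
    {x y z : E} (hx : x ∈ resolvent c A z) (hy : y ∈ resolvent c A z) : x = y := by
  obtain ⟨u, hu, hxu⟩ := hx
  obtain ⟨v, hv, hyv⟩ := hy
  have h := hA x y u v hu hv
  have e : y - x = -(c • (v - u)) := by
    have : x + c • u = y + c • v := hxu.trans hyv.symm
    rw [← sub_eq_zero] at this ⊢
    rw [← neg_eq_zero, ← this]
    module
  rw [e, inner_neg_right, real_inner_smul_right, real_inner_self_eq_norm_sq] at h
  have h0 : ‖v - u‖ ^ 2 = 0 := by
    have : 0 ≤ ‖v - u‖ ^ 2 := by positivity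
    nlinarith
  rw [pow_eq_zero_iff two_ne_zero, norm_eq_zero] at h0
  rw [h0, smul_zero, neg_zero, sub_eq_zero] at e
  exact e.symm

theorem mem_subdiff_indicatorFn_iff {S : Set E} {x u : E} :
    u ∈ subdiff (indicatorFn S) x ↔ x ∈ S ∧ ∀ y ∈ S, inner ℝ u (y - x) ≤ 0 := by
  have h0 : ∀ {y}, y ∈ S → indicatorFn S y = 0 := fun hy => by simp [indicatorFn, hy]
  have ht : ∀ {y}, y ∉ S → indicatorFn S y = ⊤ := fun hy => by simp [indicatorFn, hy]
  constructor
  · intro h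
    have hx : x ∈ S := by
      by_contra hx
      exact h.1 (ht hx)
    refine ⟨hx, fun y hy => ?_⟩
    have := h.2.2 y
    rw [h0 hx, h0 hy, zero_add] at this
    exact_mod_cast this
  · rintro ⟨hx, h⟩
    refine ⟨by simp [h0 hx], by simp [h0 hx], fun y => ?_⟩
    by_cases hy : y ∈ S
    · rw [h0 hx, h0 hy, zero_add]
      exact_mod_cast h y hy
    · rw [ht hy]; exact le_top

/-- The witness is the metric projection onto `S`; its variational inequality says that `z - x` is
normal to `S` at `x`. -/
theorem exists_mem_resolvent_indicatorFn [CompleteSpace E] {S : Set E} (hne : S.Nonempty)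
    (hS : IsClosed S) (hconv : Convex ℝ S) {c : ℝ} (hc : 0 < c) (z : E) :
    ∃ x, x ∈ resolvent c (subdiff (indicatorFn S)) z := by
  obtain ⟨x, hx, hmin⟩ := exists_norm_eq_iInf_of_complete_convex hne hS.isComplete hconv z
  rw [norm_eq_iInf_iff_real_inner_le_zero hconv hx] at hmin
  refine ⟨x, c⁻¹ • (z - x), mem_subdiff_indicatorFn_iff.2 ⟨hx, fun y hy => ?_⟩, ?_⟩
  · rw [real_inner_smul_left]
    exact mul_nonpos_of_nonneg_of_nonpos (inv_nonneg.2 hc.le) (hmin y hy)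
  · rw [smul_inv_smul₀ hc.ne', add_sub_cancel]

theorem polar_isClosed (K : Set E) : IsClosed (polar K) := by
  simp only [polar, Set.ofPred_forall]
  exact isClosed_iInter fun x => isClosed_iInter fun _ =>
    isClosed_le (by fun_prop) continuous_const

theorem polar_convex (K : Set E) : Convex ℝ (polar K) := by
  intro x hx y hy s t hs ht _ w hw
  have h1 := hx w hw
  have h2 := hy w hw
  rw [inner_add_left, real_inner_smul_left, real_inner_smul_left]
  nlinarith

/-- A closed convex cone contains every vector that is polar to its polar cone. -/
theorem mem_of_forall_polar_inner_nonpos [CompleteSpace E] {K : ConvexCone ℝ E}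
    (hne : (K : Set E).Nonempty) (hK : IsClosed (K : Set E)) {v : E}
    (h : ∀ y ∈ polar (K : Set E), inner ℝ v y ≤ 0) : v ∈ K := by
  obtain ⟨p, hp, hmin⟩ := exists_norm_eq_iInf_of_complete_convex hne hK.isComplete K.convex v
  rw [norm_eq_iInf_iff_real_inner_le_zero K.convex hp] at hmin
  have h1 : v - p ∈ polar (K : Set E) := by
    intro w hw
    simpa using hmin (p + w) (K.add_mem hp hw)
  have h2 : 0 ≤ inner ℝ (v - p) p := by
    -- A `ConvexCone` need not contain `0`, so the projection is tested against a positive multiple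
    -- of `p`.
    have := hmin ((1 / 2 : ℝ) • p) (K.smul_mem (by norm_num) hp)
    have e : (1 / 2 : ℝ) • p - p = (-(1 / 2) : ℝ) • p := by module
    rw [e, real_inner_smul_right] at this
    linarith
  have h3 := h _ h1
  have h4 : inner ℝ (v - p) (v - p) ≤ 0 := by
    conv_lhs => rw [inner_sub_right]
    rw [real_inner_comm] at h3
    linarith
  have h5 : v - p = 0 := by
    rw [real_inner_self_eq_norm_sq] at h4
    exact norm_eq_zero.1 (pow_eq_zero_iff two_ne_zero |>.1 (le_antisymm h4 (by positivity)))
  rw [sub_eq_zero.1 h5]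
  exact hp

end Resolvents

/-! ### The conic program: objective, multiplier set and edge constraints. -/

namespace ConicProgram

set_option linter.unusedSectionVars false

variable {V : Type*} [Fintype V] [DecidableEq V] {G : SimpleGraph V} [DecidableRel G.Adj]
  {H : V → Type*} [∀ i, NormedAddCommGroup (H i)] [∀ i, InnerProductSpace ℝ (H i)]
  {Y : G.edgeSet → Type*} [∀ e, NormedAddCommGroup (Y e)] [∀ e, InnerProductSpace ℝ (Y e)]

theorem localSet_isClosed (Q : ConicProgram G H Y) (i : V) : IsClosed (Q.localSet i) := by
  simp only [localSet, Set.ofPred_forall]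
  exact isClosed_iInter fun ℓ => (Q.h_ccp i ℓ).lsc.isClosed_preimage 0

theorem localSet_convex (Q : ConicProgram G H Y) (i : V) : Convex ℝ (Q.localSet i) := by
  intro x hx y hy s t hs ht hst ℓ
  have := (Q.h_ccp i ℓ).le_of_le_of_le (a := 0) (b := 0) (hx ℓ) (hy ℓ) hs ht hst
  simpa using this

theorem objective_isCCP (Q : ConicProgram G H Y) {x : PiLp 2 H} (hx : Q.objective x ≠ ⊤) :
    IsCCP Q.objective := by
  have h : IsClosedConvex Q.objective := isClosedConvex_sum Finset.univ fun i =>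
    ((Q.f_ccp i).isClosedConvex.add
      (isClosedConvex_indicatorFn (Q.localSet_isClosed i) (Q.localSet_convex i))).comp
      (PiLp.proj 2 H i)
  exact ⟨h.ne_bot, ⟨x, hx⟩, h.lsc, h.convex⟩

theorem M_isClosed (Q : ConicProgram G H Y) : IsClosed Q.M := by
  have h1 : IsClosed {l : Lifted Y | ∀ p : DirEdge G, l p ∈ polar (Q.K p.1 : Set (Y p.1))} := by
    simp only [Set.ofPred_forall]
    exact isClosed_iInter fun p => (polar_isClosed _).preimage (PiLp.continuous_apply 2 _ p)
  have h2 : IsClosed {l : Lifted Y | l = perm l} :=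
    isClosed_eq continuous_id ((PiLp.continuous_toLp 2 _).comp
      (continuous_pi fun p => PiLp.continuous_apply 2 _ _))
  exact h1.inter h2

theorem M_convex (Q : ConicProgram G H Y) : Convex ℝ Q.M := by
  intro x hx y hy s t hs ht hst
  refine ⟨fun p => polar_convex _ (hx.1 p) (hy.1 p) hs ht hst, ?_⟩
  conv_lhs => rw [hx.2, hy.2]
  rfl

/-- Elements of `M` given by one multiplier per undirected edge. -/
theorem toLp_mem_M (Q : ConicProgram G H Y) {m : ∀ e, Y e}
    (hm : ∀ e, m e ∈ polar (Q.K e : Set (Y e))) :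
    (WithLp.toLp 2 fun p : DirEdge G => m p.1 : Lifted Y) ∈ Q.M :=
  ⟨fun p => hm p.1, rfl⟩

theorem zero_mem_M (Q : ConicProgram G H Y) : (0 : Lifted Y) ∈ Q.M :=
  Q.toLp_mem_M (m := 0) fun e x _ => by simp

/-- The symmetry `l = perm l` identifies the values at both endpoints, so any chosen endpoint
represents the edge. -/
theorem exists_edge_multiplier (Q : ConicProgram G H Y) {l : Lifted Y} (hl : l ∈ Q.M) :
    ∃ m : ∀ e, Y e, (∀ e, m e ∈ polar (Q.K e : Set (Y e))) ∧ ∀ p : DirEdge G, l p = m p.1 := by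
  refine ⟨fun e => l ⟨e, ⟨(e : Sym2 V).out.1, Sym2.out_fst_mem _⟩⟩, fun e =>
    hl.1 ⟨e, ⟨(e : Sym2 V).out.1, Sym2.out_fst_mem _⟩⟩, ?_⟩
  rintro ⟨e, i, hi⟩
  have hcongr : ∀ i j (hi : i ∈ (e : Sym2 V)) (hj : j ∈ (e : Sym2 V)), j = i →
      l ⟨e, i, hi⟩ = l ⟨e, j, hj⟩ := by
    rintro i _ hi hj rfl
    rfl
  have hmem : (e : Sym2 V).out.1 ∈ s(i, Sym2.Mem.other hi) := by
    rw [Sym2.other_spec hi]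
    exact Sym2.out_fst_mem _
  rcases Sym2.mem_iff.1 hmem with h | h
  · exact hcongr _ _ _ _ h
  · have hrev : l ⟨e, i, hi⟩ = l (DirEdge.rev ⟨e, i, hi⟩) :=
      congrArg (fun l : Lifted Y => l ⟨e, i, hi⟩) hl.2
    rw [hrev]
    exact hcongr _ _ _ _ h

theorem card_endpoints (e : G.edgeSet) : Fintype.card {i : V // i ∈ (e : Sym2 V)} = 2 := by
  rw [← Sym2.card_toFinset_of_not_isDiag (e : Sym2 V) (G.not_isDiag_of_mem_edgeSet e.2)]
  exact Fintype.card_of_subtype _ fun x => Sym2.mem_toFinset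

/-- Each edge has two endpoints, and the two halves of `b` in `d` add up to `b`. This turns the
lifted pairing into one with the original constraints. -/
theorem inner_C_sub_d (Q : ConicProgram G H Y) {l : Lifted Y} {m : ∀ e, Y e}
    (hm : ∀ p : DirEdge G, l p = m p.1) (x : PiLp 2 H) :
    inner ℝ (Q.C x - Q.d) l =
      ∑ e : G.edgeSet, inner ℝ ((∑ i : {i : V // i ∈ (e : Sym2 V)}, Q.A e i (x i)) - Q.b e) (m e) := by
  rw [PiLp.inner_apply, Fintype.sum_sigma]
  refine Finset.sum_congr rfl fun e _ => ?_
  simp only [hm]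
  rw [← sum_inner]
  congr 1
  have : ∀ i : {i : V // i ∈ (e : Sym2 V)},
      (Q.C x - Q.d) ⟨e, i⟩ = Q.A e i (x i) - (1 / 2 : ℝ) • Q.b e := fun i => rfl
  simp only [this, Finset.sum_sub_distrib, Finset.sum_const, Finset.card_univ, card_endpoints]
  congr 1
  module

theorem inner_C_sub_d_nonpos (Q : ConicProgram G H Y) {l : Lifted Y} (hl : l ∈ Q.M)
    {x : PiLp 2 H} (hx : Q.Feasible x) : inner ℝ (Q.C x - Q.d) l ≤ 0 := by
  obtain ⟨m, hm, hlm⟩ := Q.exists_edge_multiplier hl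
  rw [Q.inner_C_sub_d hlm]
  refine Finset.sum_nonpos fun e _ => ?_
  rw [real_inner_comm]
  exact hm e _ (hx e)

/-- Multipliers supported on a single edge reduce this to the bipolar theorem for one cone. -/
theorem feasible_of_inner_nonpos [∀ e, CompleteSpace (Y e)] (Q : ConicProgram G H Y)
    (hne : ∀ e, (Q.K e : Set (Y e)).Nonempty) {x : PiLp 2 H}
    (h : ∀ l ∈ Q.M, inner ℝ (Q.C x - Q.d) l ≤ 0) : Q.Feasible x := by
  intro e
  refine mem_of_forall_polar_inner_nonpos (hne e) (Q.K_closed e) fun y hy => ?_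
  have hm : ∀ e', (Pi.single e y : ∀ e, Y e) e' ∈ polar (Q.K e' : Set (Y e')) := by
    intro e'
    by_cases he : e' = e
    · subst he; simpa using hy
    · rw [Pi.single_eq_of_ne he]; intro w _; simp
  have h1 := h _ (Q.toLp_mem_M hm)
  rw [Q.inner_C_sub_d (m := Pi.single e y) (fun p => rfl), Finset.sum_eq_single e] at h1
  · simpa using h1
  · intro e' _ he
    rw [Pi.single_eq_of_ne he, inner_zero_right]
  · intro h; exact absurd (Finset.mem_univ e) h

/-! ### The operators `T₁`, `T₂`, `T` and their fixed points. -/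

variable [∀ i, CompleteSpace (H i)] [∀ e, CompleteSpace (Y e)]

theorem T₁_monotone (Q : ConicProgram G H Y) (l l' w w' : Lifted Y) (hw : w ∈ Q.T₁ l)
    (hw' : w' ∈ Q.T₁ l') : 0 ≤ inner ℝ (w' - w) (l' - l) := by
  obtain ⟨u, hu, rfl⟩ := hw
  obtain ⟨u', hu', rfl⟩ := hw'
  have h := subdiff_inner_nonneg hu hu'
  have e : -Q.C u' + Q.d - (-Q.C u + Q.d) = -Q.C (u' - u) := by rw [map_sub]; abel
  have e' : -ContinuousLinearMap.adjoint Q.C l' - -ContinuousLinearMap.adjoint Q.C l =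
      -ContinuousLinearMap.adjoint Q.C (l' - l) := by rw [map_sub]; abel
  rw [e', inner_neg_right, ContinuousLinearMap.adjoint_inner_right] at h
  rwa [e, inner_neg_left]

theorem T₂_monotone (Q : ConicProgram G H Y) (l m w v : Lifted Y) (hw : w ∈ Q.T₂ l)
    (hv : v ∈ Q.T₂ m) : 0 ≤ inner ℝ (v - w) (m - l) :=
  subdiff_inner_nonneg hw hv

/-- The multiplier `z + c (C x - d)` attached to a primal update is the resolvent of `T₁`. -/
theorem neg_C_add_d_mem_T₁ (Q : ConicProgram G H Y) (hf : IsCCP Q.objective) {c : ℝ} (hc : 0 < c)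
    {z : Lifted Y} {x : PiLp 2 H} (hx : x ∈ Q.primalUpdate c z) :
    -Q.C x + Q.d ∈ Q.T₁ (z + c • (Q.C x - Q.d)) :=
  ⟨x, mem_subdiff_conjugate ((isMinOn_augmented_iff hf Q.C z Q.d hc.le).1 hx), rfl⟩

theorem add_smul_neg_C_add_d (Q : ConicProgram G H Y) (c : ℝ) (z : Lifted Y) (x : PiLp 2 H) :
    z + c • (Q.C x - Q.d) + c • (-Q.C x + Q.d) = z := by module

/-- The primal update supplies a point of the resolvent, and monotonicity of `T₁` excludes any
other. -/
theorem mem_reflectedResolvent_T₁_iff (Q : ConicProgram G H Y) (hf : IsCCP Q.objective) {c : ℝ}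
    (hc : 0 < c) {z y : Lifted Y} {x : PiLp 2 H} (hx : x ∈ Q.primalUpdate c z) :
    y ∈ reflectedResolvent c Q.T₁ z ↔ y = (2 : ℝ) • (z + c • (Q.C x - Q.d)) - z := by
  have hmem : z + c • (Q.C x - Q.d) ∈ resolvent c Q.T₁ z :=
    ⟨_, Q.neg_C_add_d_mem_T₁ hf hc hx, Q.add_smul_neg_C_add_d c z x⟩
  constructor
  · rintro ⟨l, hl, rfl⟩
    rw [eq_of_mem_resolvent Q.T₁_monotone hc hl hmem]
  · rintro rfl
    exact ⟨_, hmem, rfl⟩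

theorem existsUnique_reflectedResolvent_T₂ (Q : ConicProgram G H Y) {c : ℝ} (hc : 0 < c)
    (y : Lifted Y) : ∃! w, w ∈ reflectedResolvent c Q.T₂ y := by
  obtain ⟨l, hl⟩ := exists_mem_resolvent_indicatorFn ⟨0, Q.zero_mem_M⟩ Q.M_isClosed Q.M_convex hc y
  refine ⟨_, ⟨l, hl, rfl⟩, ?_⟩
  rintro _ ⟨l', hl', rfl⟩
  rw [eq_of_mem_resolvent Q.T₂_monotone hc hl' hl]

theorem existsUnique_mem_primalUpdate (Q : ConicProgram G H Y) (hf : IsCCP Q.objective)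
    {φ : ℝ≥0 → ℝ≥0} (hφ : UniformlyMonotone (subdiff Q.objective) φ) {c : ℝ} (hc : 0 < c)
    (z : Lifted Y) : ∃! x, x ∈ Q.primalUpdate c z :=
  existsUnique_isMinOn_augmented hf hφ Q.C z Q.d hc.le

theorem existsUnique_mem_T (Q : ConicProgram G H Y) (hf : IsCCP Q.objective)
    {φ : ℝ≥0 → ℝ≥0} (hφ : UniformlyMonotone (subdiff Q.objective) φ) {c : ℝ} (hc : 0 < c)
    (z : Lifted Y) : ∃! w, w ∈ Q.T c z := by
  obtain ⟨x, hx, -⟩ := Q.existsUnique_mem_primalUpdate hf hφ hc z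
  obtain ⟨w, hw, huniq⟩ := Q.existsUnique_reflectedResolvent_T₂ hc
    ((2 : ℝ) • (z + c • (Q.C x - Q.d)) - z)
  refine ⟨w, ⟨_, (Q.mem_reflectedResolvent_T₁_iff hf hc hx).2 rfl, hw⟩, ?_⟩
  rintro v ⟨y, hy, hv⟩
  rw [Q.mem_reflectedResolvent_T₁_iff hf hc hx] at hy
  subst hy
  exact huniq v hv

/-- `T` is nonexpansive, with a gain measured by the distance of the primal updates. -/
theorem norm_T_sub_sq_add_le (Q : ConicProgram G H Y) (hf : IsCCP Q.objective)
    {φ : ℝ≥0 → ℝ≥0} (hφ : UniformlyMonotone (subdiff Q.objective) φ) {c : ℝ} (hc : 0 < c)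
    {z z' w w' : Lifted Y} {x x' : PiLp 2 H} (hw : w ∈ Q.T c z) (hw' : w' ∈ Q.T c z')
    (hx : x ∈ Q.primalUpdate c z) (hx' : x' ∈ Q.primalUpdate c z') :
    ‖w - w'‖ ^ 2 + 4 * c * (φ ‖x - x'‖₊ : ℝ) ≤ ‖z - z'‖ ^ 2 := by
  obtain ⟨y, hy, l, ⟨u, hu, hlu⟩, rfl⟩ := hw
  obtain ⟨y', hy', l', ⟨u', hu', hlu'⟩, rfl⟩ := hw'
  rw [Q.mem_reflectedResolvent_T₁_iff hf hc hx] at hy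
  rw [Q.mem_reflectedResolvent_T₁_iff hf hc hx'] at hy'
  have h1 := norm_reflected_sub_sq hlu hlu'
  have h2 := Q.T₂_monotone _ _ _ _ hu' hu
  have h3 := norm_reflected_sub_sq (Q.add_smul_neg_C_add_d c z x) (Q.add_smul_neg_C_add_d c z' x')
  rw [← hy, ← hy'] at h3
  -- Once the adjoint is moved across, this pairing is exactly the cross term of `h3`.
  have h4 := hφ.le_inner x' x _ _ ((isMinOn_augmented_iff hf Q.C z' Q.d hc.le).1 hx')
    ((isMinOn_augmented_iff hf Q.C z Q.d hc.le).1 hx)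
  set m := z + c • (Q.C x - Q.d) with hm
  set m' := z' + c • (Q.C x' - Q.d) with hm'
  have e : -Q.C x + Q.d - (-Q.C x' + Q.d) = -Q.C (x - x') := by rw [map_sub]; abel
  have e' : -ContinuousLinearMap.adjoint Q.C m - -ContinuousLinearMap.adjoint Q.C m' =
      -ContinuousLinearMap.adjoint Q.C (m - m') := by rw [map_sub]; abel
  rw [e', inner_neg_left, ContinuousLinearMap.adjoint_inner_left, real_inner_comm,
    ← inner_neg_left, ← e] at h4
  have h5 := mul_le_mul_of_nonneg_left h4 (show 0 ≤ 4 * c by positivity)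
  have h6 : 0 ≤ 4 * c * inner ℝ (u - u') (l - l') := by positivity
  linarith

/-- The primal update at a fixed point of `T` is the primal solution. -/
theorem eq_of_mem_T_self (Q : ConicProgram G H Y) (hf : IsCCP Q.objective)
    {φ : ℝ≥0 → ℝ≥0} (hφ : UniformlyMonotone (subdiff Q.objective) φ) {c : ℝ} (hc : 0 < c)
    {z : Lifted Y} (hz : z ∈ Q.T c z) {x : PiLp 2 H} (hx : x ∈ Q.primalUpdate c z)
    {xs : PiLp 2 H} (hxs : Q.IsPrimalSolution xs) : x = xs := by
  obtain ⟨y, hy, l, ⟨u, hu, hlu⟩, hzl⟩ := hz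
  rw [Q.mem_reflectedResolvent_T₁_iff hf hc hx] at hy
  have hsub := (isMinOn_augmented_iff hf Q.C z Q.d hc.le).1 hx
  set m := z + c • (Q.C x - Q.d) with hm
  -- At a fixed point, `z = 2l - y` and `y = 2m - z` force the two resolvents to agree, which puts
  -- `Q.C x - Q.d` in the normal cone of `M` at `m`.
  have hlm : l = m := by
    have h2 : (2 : ℝ) • l = (2 : ℝ) • m := by
      rw [hy] at hzl
      have := congrArg (fun v => v + ((2 : ℝ) • m - z)) hzl
      simpa using this.symm
    exact smul_right_injective _ (two_ne_zero' ℝ) h2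
  have hu' : u = Q.C x - Q.d := by
    have h2 : c • u = c • (Q.C x - Q.d) := by
      rw [hlm, hy] at hlu
      have h3 : c • u = m - z := by
        rw [← sub_eq_zero] at hlu ⊢
        rw [← hlu]
        module
      rw [h3, hm, add_sub_cancel_left]
    exact smul_right_injective _ hc.ne' h2
  rw [hu', hlm] at hu
  obtain ⟨hmM, hnormal⟩ := mem_subdiff_indicatorFn_iff.1 hu
  -- Complementary slackness: testing the normal cone at `0` and at `2m` makes the pairing vanish.
  have hcompl : 0 ≤ inner ℝ (Q.C x - Q.d) m := by
    have := hnormal 0 Q.zero_mem_M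
    rw [zero_sub, inner_neg_right] at this
    linarith
  have hdouble : (2 : ℝ) • m ∈ Q.M := by
    refine ⟨fun p w hw => ?_, ?_⟩
    · have := hmM.1 p w hw
      change inner ℝ ((2 : ℝ) • m p) w ≤ 0
      rw [real_inner_smul_left]
      linarith
    · conv_lhs => rw [hmM.2]
      rfl
  have hcompl' : inner ℝ (Q.C x - Q.d) m ≤ 0 := by
    have := hnormal _ hdouble
    rwa [two_smul, add_sub_cancel_right] at this
  have hfeas : Q.Feasible x := by
    -- Feasibility of `xs` shows that no cone is empty.
    refine Q.feasible_of_inner_nonpos (fun e => ⟨_, hxs.1 e⟩) fun l hl => ?_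
    have := hnormal l hl
    rw [inner_sub_right] at this
    linarith
  have hle := hxs.2.2 x hfeas
  obtain ⟨r, hr⟩ := subdiff_exists_real hsub
  obtain ⟨s, hs⟩ : ∃ s : ℝ, Q.objective xs = s :=
    ⟨_, (EReal.coe_toReal hxs.2.1 (hf.ne_bot xs)).symm⟩
  have hsr : s ≤ r := by
    rw [hr, hs] at hle
    exact_mod_cast hle
  have h1 := (mem_subdiff_iff_real hr).1 hsub xs s hs.le
  have h2 := Q.inner_C_sub_d_nonpos hmM hxs.1
  have h3 : inner ℝ (-ContinuousLinearMap.adjoint Q.C m) (xs - x) =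
      inner ℝ (Q.C x - Q.d) m - inner ℝ (Q.C xs - Q.d) m := by
    rw [inner_neg_left, ContinuousLinearMap.adjoint_inner_left, real_inner_comm, map_sub,
      ← inner_neg_left, ← inner_sub_left]
    congr 1
    abel
  -- As `xs` is optimal and feasible, passing from `x` to `xs` only weakens the subgradient
  -- inequality. Both points thus share one subgradient, and uniform monotonicity identifies them.
  have hsub' : -ContinuousLinearMap.adjoint Q.C m ∈ subdiff Q.objective xs := by
    rw [mem_subdiff_iff_real hs]
    intro y a hya
    have h4 := (mem_subdiff_iff_real hr).1 hsub y a hya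
    have e : y - x = (y - xs) + (xs - x) := by abel
    rw [e, inner_add_right] at h4
    linarith
  exact hφ.eq_of_mem_of_mem hsub hsub'

end ConicProgram

/-- Monotonicity turns `φ t < φ κ` into `t < κ`, and `φ κ > 0` for `κ > 0`; no continuity of `φ` is
needed. -/
theorem tendsto_of_tendsto_modulus {E α : Type*} [NormedAddCommGroup E] {l : Filter α}
    {φ : ℝ≥0 → ℝ≥0} (hmono : Monotone φ) (hzero : ∀ t, φ t = 0 ↔ t = 0) {x : α → E} {y : E}
    (h : Tendsto (fun k => (φ ‖x k - y‖₊ : ℝ)) l (𝓝 0)) : Tendsto x l (𝓝 y) := by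
  refine Metric.tendsto_nhds.2 fun κ hκ => ?_
  lift κ to ℝ≥0 using hκ.le
  have hκ' : 0 < κ := hκ
  have hφ : (0 : ℝ) < φ κ := NNReal.coe_pos.2 (pos_iff_ne_zero.2 fun h0 => hκ'.ne' ((hzero κ).1 h0))
  filter_upwards [h.eventually (gt_mem_nhds hφ)] with k hk
  rw [dist_eq_norm, ← coe_nnnorm, NNReal.coe_lt_coe]
  by_contra! hge
  exact absurd (hmono hge) (not_le.2 (by exact_mod_cast hk))

end GPDMM

theorem proposition2 {V : Type*} [Fintype V] [DecidableEq V]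
    (G : SimpleGraph V) [DecidableRel G.Adj]
    (H : V → Type*) [∀ i, NormedAddCommGroup (H i)] [∀ i, InnerProductSpace ℝ (H i)]
    [∀ i, CompleteSpace (H i)]
    (Y : G.edgeSet → Type*) [∀ e, NormedAddCommGroup (Y e)] [∀ e, InnerProductSpace ℝ (Y e)]
    [∀ e, CompleteSpace (Y e)]
    (Q : GPDMM.ConicProgram G H Y) (c : ℝ) (hc : 0 < c)
    (hfix : ∃ z, z ∈ Q.T c z)
    (φ : ℝ≥0 → ℝ≥0) (hφ : GPDMM.UniformlyMonotone (GPDMM.subdiff Q.objective) φ)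
    (xstar : PiLp 2 H) (hxstar : Q.IsPrimalSolution xstar)
    {Ω : Type*} [MeasurableSpace Ω] (μ : Measure Ω) [IsProbabilityMeasure μ]
    (χ : ℕ → Ω → GPDMM.DirEdge G → Bool) (hχ_meas : ∀ k, Measurable (χ k))
    (hχ_indep : iIndepFun χ μ) (hχ_ident : ∀ k, IdentDistrib (χ k) (χ 0) μ μ)
    (hχ_pos : ∀ p, 0 < μ {ω | χ 0 ω p = true}) :
    -- the iteration is well defined from every point
    (∀ z, ∃! w, w ∈ Q.T c z) ∧ (∀ z, ∃! x, x ∈ Q.primalUpdate c z) ∧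
    -- and its primal iterates converge almost surely
    ∀ (z₀ : GPDMM.ConicProgram.Lifted Y) (Z : ℕ → Ω → GPDMM.ConicProgram.Lifted Y)
      (X : ℕ → Ω → PiLp 2 H), Q.IsStochasticIteration c χ z₀ Z X →
      ∀ᵐ ω ∂μ, Tendsto (fun k => X k ω) atTop (𝓝 xstar) := by
  have hf := Q.objective_isCCP hxstar.2.1
  have hT := Q.existsUnique_mem_T hf hφ hc
  have hP := Q.existsUnique_mem_primalUpdate hf hφ hc
  refine ⟨hT, hP, fun z₀ Z X hZ => ?_⟩
  choose T hTmem hTuniq using hT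
  choose P hPmem hPuniq using hP
  obtain ⟨zs, hzs⟩ := hfix
  -- This lets the gain of `T` relative to `zs` measure the distance to `xstar`.
  have hxs : xstar ∈ Q.primalUpdate c zs := by
    rw [← Q.eq_of_mem_T_self hf hφ hc hzs (hPmem zs) hxstar]
    exact hPmem zs
  have hdecr := GPDMM.ae_tendsto_decrement_zero (T := T) (zs := zs)
    (ψ := fun z => 4 * c * (φ ‖P z - xstar‖₊ : ℝ)) (fun z => by positivity)
    (fun z => Q.norm_T_sub_sq_add_le hf hφ hc (hTmem z) hzs (hPmem z) hxs)
    hχ_meas hχ_indep hχ_ident hχ_pos hZ.init (Z := Z) fun k ω p => by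
      obtain ⟨w, hw, hstep⟩ := hZ.step k ω
      rw [hstep, hTuniq _ w hw]
      change (Z k ω p - if χ k ω p then Z k ω p else 0) +
        (if χ k ω p then T (Z k ω) p else 0) = _
      split_ifs <;> simp
  filter_upwards [hdecr] with ω hω
  refine GPDMM.tendsto_of_tendsto_modulus hφ.mono hφ.eq_zero_iff ?_
  have h := hω.const_mul (4 * c)⁻¹
  simp only [mul_zero, inv_mul_cancel_left₀ (show 4 * c ≠ 0 by positivity)] at h
  simpa only [← hPuniq _ _ (hZ.primal _ ω)] using h
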